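/- Let $R$ be a commutative ring and let $\mathrm{Ch}_{\ge 0}(R)$ be the category of non-negatively graded chain complexes of $R$-modules. It is closed symmetric monoidal, hence enriched, tensored and cotensored over itself: the tensor product is $(X\otimes Y)_n=\bigoplus_{i+j=n}X_i\otimes_R Y_j$ with $d(x\otimes y)=dx\otimes y+(-1)^{|x|}x\otimes dy$ and symmetry $x\otimes y\mapsto(-1)^{|x||y|}y\otimes x$, the unit is $R$ concentrated in degree $0$, and the internal hom $\underline{\mathrm{Hom}}(X,Y)$ is the good truncation in degrees $\ge 0$ of the complex with $\prod_p\mathrm{Hom}_R(X_p,Y_{p+n})$ in degree $n$ and $(df)(x)=d(f(x))-(-1)^{|f|}f(dx)$. A closed symmetric monoidal category $\mathcal V$ with a model structure is a *monoidal model category* if (i) for all cofibrations $i:X\to Y$ and $k:V\to W$ the pushout-product $i\,\square\,k:(X\otimes W)\amalg_{X\otimes V}(Y\otimes V)\to Y\otimes W$ is a cofibration, which is acyclic if $i$ or $k$ is; and (ii) for every cofibrant $X$ and every weak equivalence $Q\to\mathbb 1$ with $Q$ cofibrant, the composition $X\otimes Q\to X\otimes\mathbb 1\cong X$ is a weak equivalence.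 A $\mathcal V$-enriched, tensored and cotensored category $\mathcal C$ with a model structure on its underlying category is *enriched over* the monoidal model category $\mathcal V$ (as a model category) if (i) and (ii) hold with $i$ a cofibration of $\mathcal C$, $k$ a cofibration of $\mathcal V$, $X$ a cofibrant object of $\mathcal C$, and $Q\to\mathbb 1$ a weak equivalence in $\mathcal V$ with $Q$ cofibrant. The category $\mathrm{Ch}_{\ge 0}(R)$ carries the following three model structures. * The projective model structure $q$: weak equivalences are the quasi-isomorphisms, fibrations are the chain maps that are epimorphisms in all positive degrees, cofibrations are the degreewise monomorphisms with degreewise projective cokernel. * The Hurewicz model structure $h$: weak equivalences are the chain homotopy equivalences, fibrations are the chain maps that are split epimorphisms in each positive degree, cofibrations are the degreewise split monomorphisms. * The mixed model structure $m$: weak equivalences are the quasi-isomorphisms, fibrations are the chain maps that are split epimorphisms in each positive degree, cofibrations are the chain maps with the left lifting property with respect to the fibrations that are quasi-isomorphisms. With the self-enrichment above, $\mathrm{Ch}_{\ge 0}(R)_q$ and $\mathrm{Ch}_{\ge 0}(R)_m$ are monoidal model categories, and 1. $\mathrm{Ch}_{\ge 0}(R)_h$ is enriched over $\mathrm{Ch}_{\ge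 0}(R)_q$; 2. $\mathrm{Ch}_{\ge 0}(R)_h$ is enriched over $\mathrm{Ch}_{\ge 0}(R)_m$; 3. $\mathrm{Ch}_{\ge 0}(R)_m$ is enriched over $\mathrm{Ch}_{\ge 0}(R)_q$. -/

import Mathlib

open CategoryTheory Limits MonoidalCategory HomologicalComplex HomotopicalAlgebra

universe v v' u u'

set_option linter.unusedSectionVars false

namespace EnrichedModel

section Enriched

variable (V : Type u) [Category.{v} V] [MonoidalCategory V] [SymmetricCategory V] [MonoidalClosed V]
variable (C : Type u') [Category.{v'} C] [EnrichedOrdinaryCategory V C]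

variable {V C} in
/-- The comparison map `Hom(T, Y) ⟶ [K, Hom(X, Y)]` induced by `η : K ⟶ Hom(X, T)`. The object `T`
is a tensor of `X` by `K`, with universal morphism `η`, when this map is an isomorphism for all `Y`. -/
def tensorComparison {X T : C} {K : V} (η : K ⟶ (X ⟶[V] T)) (Y : C) :
    (T ⟶[V] Y) ⟶ (ihom K).obj (X ⟶[V] Y) :=
  MonoidalClosed.curry (η ▷ (T ⟶[V] Y) ≫ eComp V X T Y)

variable {V C} in
/-- The comparison map `Hom(X, E) ⟶ [K, Hom(X, Y)]` induced by `ε : K ⟶ Hom(E, Y)`. The object `E`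
is a cotensor of `Y` by `K`, with universal morphism `ε`, when this map is an isomorphism for all
`X`. -/
def cotensorComparison {E Y : C} {K : V} (ε : K ⟶ (E ⟶[V] Y)) (X : C) :
    (X ⟶[V] E) ⟶ (ihom K).obj (X ⟶[V] Y) :=
  MonoidalClosed.curry ((β_ K (X ⟶[V] E)).hom ≫ (X ⟶[V] E) ◁ ε ≫ eComp V X E Y)

/-- The structure of a tensored and cotensored `V`-enriched category on the `V`-enriched category `C`.
Tensors and cotensors are given by enriched universal properties; `coev X K : K ⟶ Hom(X, X ⊗ K)` and
`ev K Y : K ⟶ Hom(Y ^ K, Y)` are the universal morphisms. -/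
structure TensorCotensor where
  /-- the tensor `(X, K) ↦ X ⊗ K` -/
  tensor : C ⥤ V ⥤ C
  /-- the universal morphism of the tensor -/
  coev (X : C) (K : V) : K ⟶ (X ⟶[V] (tensor.obj X).obj K)
  coev_naturality (X : C) {K L : V} (k : K ⟶ L) :
    k ≫ coev X L = coev X K ≫ eHomWhiskerLeft V X ((tensor.obj X).map k)
  coev_dinaturality {X Y : C} (f : X ⟶ Y) (K : V) :
    coev X K ≫ eHomWhiskerLeft V X ((tensor.map f).app K) =
      coev Y K ≫ eHomWhiskerRight V f ((tensor.obj Y).obj K)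
  isIso_tensorComparison (X : C) (K : V) (Y : C) : IsIso (tensorComparison (coev X K) Y)
  /-- the canonical morphism `X ⊗ 𝟙 ⟶ X`, which corresponds to the identity of `X` -/
  unitor (X : C) : (tensor.obj X).obj (𝟙_ V) ⟶ X
  coev_unitor (X : C) : coev X (𝟙_ V) ≫ eHomWhiskerLeft V X (unitor X) = eId V X
  /-- the cotensor `(K, Y) ↦ Y ^ K` -/
  cotensor (K : V) (Y : C) : C
  /-- the universal morphism of the cotensor -/
  ev (K : V) (Y : C) : K ⟶ (cotensor K Y ⟶[V] Y)
  isIso_cotensorComparison (K : V) (Y X : C) : IsIso (cotensorComparison (ev K Y) X)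

open MonoidalClosed

variable {V}
lemma selfTensor_comp (X K Y : V) :
    (ihom.coev X).app K ▷ (ihom (X ⊗ K)).obj Y ≫ MonoidalClosed.comp X (X ⊗ K) Y =
      MonoidalClosed.curry ((α_ X K _).inv ≫ (ihom.ev (X ⊗ K)).app Y) := by
  apply MonoidalClosed.uncurry_injective
  rw [uncurry_natural_left, MonoidalClosed.comp, uncurry_curry, uncurry_curry, compTranspose_eq]
  have h := ihom.ev_coev X K
  change X ◁ (ihom.coev X).app K ≫ (ihom.ev X).app (X ⊗ K) = 𝟙 _ at h
  exact (associator_inv_naturality_middle_assoc X ((ihom.coev X).app K : K ⟶ (ihom X).obj (X ⊗ K))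
    _ _).trans (by rw [← comp_whiskerRight_assoc, h, id_whiskerRight, Category.id_comp]; rfl)

lemma selfCotensor_aux {X H E K W Y : V} (e : X ⊗ H ⟶ E) (c : K ⟶ W) (w : E ⊗ W ⟶ Y) :
    X ◁ H ◁ c ≫ (α_ X H W).inv ≫ e ▷ W ≫ w = (α_ X H K).inv ≫ e ▷ K ≫ E ◁ c ≫ w := by
  rw [associator_inv_naturality_right_assoc, whisker_exchange_assoc]

lemma selfCotensor_aux' {X H E K Y : V} (e : X ⊗ H ⟶ E) (w : K ⊗ E ⟶ Y) :
    X ◁ (β_ K H).hom ≫ (α_ X H K).inv ≫ e ▷ K ≫ (β_ E K).hom ≫ w =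
      (α_ X K H).inv ≫ (β_ X K).hom ▷ H ≫ (α_ K X H).hom ≫ K ◁ e ≫ w := by
  rw [BraidedCategory.braiding_naturality_left_assoc, BraidedCategory.braiding_tensor_left_hom]
  simp only [Category.assoc, Iso.inv_hom_id_assoc]
  rw [← MonoidalCategory.whiskerLeft_comp_assoc, SymmetricCategory.symmetry]
  simp

lemma selfCotensor (X K Y : V) :
    MonoidalClosed.curry ((β_ K ((ihom X).obj ((ihom K).obj Y))).hom ≫
      (ihom X).obj ((ihom K).obj Y) ◁
        (MonoidalClosed.curry ((β_ ((ihom K).obj Y) K).hom ≫ (ihom.ev K).app Y)) ≫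
        MonoidalClosed.comp X ((ihom K).obj Y) Y) = 
      ihomUncurry K X Y ≫ (pre (β_ X K).hom).app Y ≫ ihomCurry X K Y := by
  apply MonoidalClosed.uncurry_injective
  apply MonoidalClosed.uncurry_injective
  have hR : MonoidalClosed.uncurry (MonoidalClosed.uncurry
      (ihomUncurry K X Y ≫ (pre (β_ X K).hom).app Y ≫ ihomCurry X K Y)) =
      (α_ X K _).inv ≫ (β_ X K).hom ▷ _ ≫ (α_ K X _).hom ≫
        K ◁ (ihom.ev X).app ((ihom K).obj Y) ≫ (ihom.ev K).app Y := by
    rw [← Category.assoc (ihomUncurry K X Y), uncurry_natural_left, uncurry_natural_left,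
      uncurry_uncurry_ihomCurry, associator_inv_naturality_right_assoc, ← uncurry_eq,
      uncurry_natural_left, uncurry_pre]
    refine congrArg ((α_ X K _).inv ≫ ·) ((whisker_exchange_assoc _ _ _).trans
      (congrArg ((β_ X K).hom ▷ _ ≫ ·) ?_))
    exact uncurry_ihomUncurry K X Y
  have hL : MonoidalClosed.uncurry (MonoidalClosed.uncurry (MonoidalClosed.curry
      ((β_ K ((ihom X).obj ((ihom K).obj Y))).hom ≫ (ihom X).obj ((ihom K).obj Y) ◁
        (MonoidalClosed.curry ((β_ ((ihom K).obj Y) K).hom ≫ (ihom.ev K).app Y)) ≫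
        MonoidalClosed.comp X ((ihom K).obj Y) Y))) =
      X ◁ (β_ K ((ihom X).obj ((ihom K).obj Y))).hom ≫ (α_ X _ K).inv ≫
        (ihom.ev X).app ((ihom K).obj Y) ▷ K ≫ (β_ ((ihom K).obj Y) K).hom ≫
          (ihom.ev K).app Y := by
    rw [uncurry_curry, uncurry_natural_left, uncurry_natural_left, MonoidalClosed.comp,
      uncurry_curry, compTranspose_eq]
    refine congrArg (X ◁ (β_ K _).hom ≫ ·) ((selfCotensor_aux _ _ _).trans ?_)
    exact congrArg (fun t => (α_ X _ K).inv ≫ (ihom.ev X).app ((ihom K).obj Y) ▷ K ≫ t)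
      ((uncurry_eq _).symm.trans (uncurry_curry ((β_ ((ihom K).obj Y) K).hom ≫
        (ihom.ev K).app Y)))
  rw [hL, hR]
  exact selfCotensor_aux' _ _

variable (V)
/-- A closed symmetric monoidal category, enriched over itself by its internal hom, is tensored over
itself by `⊗` and cotensored over itself by the internal hom. -/
noncomputable def selfTensorCotensor : TensorCotensor V V where
  tensor := curriedTensor V
  coev X K := (ihom.coev X).app K
  coev_naturality X {K L} k := by
    rw [enrichedOrdinaryCategorySelf_eHomWhiskerLeft]
    exact (ihom.coev X).naturality k
  coev_dinaturality {X Y} f K := by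
    rw [enrichedOrdinaryCategorySelf_eHomWhiskerLeft, enrichedOrdinaryCategorySelf_eHomWhiskerRight]
    exact (coev_app_comp_pre_app (X := K) f).symm
  isIso_tensorComparison X K Y := by
    have : tensorComparison (V := V) (C := V) ((ihom.coev X).app K) Y = ihomCurry X K Y :=
      congrArg MonoidalClosed.curry (selfTensor_comp X K Y)
    rw [this]
    exact (ihomCurryIso X K Y).isIso_hom
  unitor X := (ρ_ X).hom
  coev_unitor X := by
    rw [enrichedOrdinaryCategorySelf_eHomWhiskerLeft, enrichedCategorySelf_id, MonoidalClosed.id_eq,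
      MonoidalClosed.curry_eq]
  cotensor K Y := (ihom K).obj Y
  ev K Y := MonoidalClosed.curry ((β_ ((ihom K).obj Y) K).hom ≫ (ihom.ev K).app Y)
  isIso_cotensorComparison K Y X := by
    have h : cotensorComparison (V := V) (C := V)
        (MonoidalClosed.curry ((β_ ((ihom K).obj Y) K).hom ≫ (ihom.ev K).app Y)) X =
        (ihomCurryIso K X Y).inv ≫ (pre (β_ X K).hom).app Y ≫ (ihomCurryIso X K Y).hom :=
      selfCotensor X K Y
    have h1 : IsIso ((pre (β_ X K).hom).app Y) :=
      ⟨(pre (β_ X K).inv).app Y, by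
        rw [← NatTrans.comp_app, ← pre_map, Iso.inv_hom_id, pre_id]; rfl, by
        rw [← NatTrans.comp_app, ← pre_map, Iso.hom_inv_id, pre_id]; rfl⟩
    rw [h]
    infer_instance

end Enriched

section ModelCategories

variable {V : Type u} [Category.{v} V] {C : Type u'} [Category.{v'} C]

/-- The weak equivalences of a model structure. -/
def weq (M : ModelCategory C) : MorphismProperty C :=
  M.categoryWithWeakEquivalences.weakEquivalences

/-- The cofibrations of a model structure. -/
def cof (M : ModelCategory C) : MorphismProperty C :=
  M.categoryWithCofibrations.cofibrations

/-- The fibrations of a model structure. -/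
def fib (M : ModelCategory C) : MorphismProperty C :=
  M.categoryWithFibrations.fibrations

/-- `X` is cofibrant in the model structure `M`: the map from the initial object is a cofibration. -/
def Cofibrant (M : ModelCategory C) (X : C) : Prop :=
  letI := M
  IsCofibrant X

/-- The pushout-product axiom for a bifunctor `⊗ : C × V → C` and model structures on `C` and `V`:
for cofibrations `i : X ⟶ Y` in `C` and `k : V₁ ⟶ W₁` in `V`, the induced morphism
`(X ⊗ W₁) ⨿_{X ⊗ V₁} (Y ⊗ V₁) ⟶ Y ⊗ W₁` out of the pushout (of which `sq` is a choice) is a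
cofibration, which is acyclic if `i` or `k` is. -/
def PushoutProductAxiom (T : C ⥤ V ⥤ C) (MV : ModelCategory V) (MC : ModelCategory C) : Prop :=
  ∀ ⦃X Y : C⦄ (i : X ⟶ Y) ⦃V₁ W₁ : V⦄ (k : V₁ ⟶ W₁), cof MC i → cof MV k →
    ∀ sq : T.PushoutObjObj i k,
      cof MC sq.ι ∧ (weq MC i ∨ weq MV k → weq MC sq.ι)

/-- The unit axiom: for every cofibrant `X` in `C` and every cofibrant replacement `q : Q ⟶ 𝟙` of the
tensor unit of `V`, the composition `X ⊗ Q ⟶ X ⊗ 𝟙 ⟶ X` is a weak equivalence. -/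
def UnitAxiom [MonoidalCategory V] (T : C ⥤ V ⥤ C) (r : ∀ X : C, (T.obj X).obj (𝟙_ V) ⟶ X)
    (MV : ModelCategory V) (MC : ModelCategory C) : Prop :=
  ∀ X : C, Cofibrant MC X → ∀ (Q : V) (q : Q ⟶ 𝟙_ V), Cofibrant MV Q → weq MV q →
    weq MC ((T.obj X).map q ≫ r X)

/-- The model structure `M` makes the closed symmetric monoidal category `V` a monoidal model
category. -/
structure IsMonoidalModelCategory [MonoidalCategory V] [SymmetricCategory V] [MonoidalClosed V]
    (M : ModelCategory V) : Prop where
  pushoutProduct : PushoutProductAxiom (curriedTensor V) M M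
  unit : UnitAxiom (curriedTensor V) (fun X => (ρ_ X).hom) M M

/-- The tensored and cotensored `V`-enriched category `C` (with the data `T`), with the model structure
`MC` on its underlying category, is an enriched model category over the monoidal model category `V`
(with the model structure `MV`). -/
structure IsEnrichedModelCategory [MonoidalCategory V] [SymmetricCategory V] [MonoidalClosed V]
    [EnrichedOrdinaryCategory V C] (T : TensorCotensor V C)
    (MV : ModelCategory V) (MC : ModelCategory C) : Prop where
  monoidal : IsMonoidalModelCategory MV
  pushoutProduct : PushoutProductAxiom T.tensor MV MC
  unit : UnitAxiom T.tensor T.unitor MV MC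

end ModelCategories

end EnrichedModel

/-- The category `Ch_{≥ 0}(R)` of non-negatively graded chain complexes of `R`-modules. -/
abbrev ChNN (R : Type u) [CommRing R] := ChainComplex (ModuleCat.{u} R) ℕ

namespace ChNN

variable {R : Type u} [CommRing R]

/-- The inclusion of the summand `K_i ⊗ L_j` into `(K ⊗ L)_n` for `i + j = n`. -/
noncomputable def incl (K L : ChNN R) (i j n : ℕ) (h : i + j = n) : K.X i ⊗ L.X j ⟶ (K ⊗ L).X n :=
  ιTensorObj K L i j n h

lemma tensor_hom_ext {K L : ChNN R} {n : ℕ} {A : ModuleCat.{u} R} {f g : (K ⊗ L).X n ⟶ A}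
    (h : ∀ (i j : ℕ) (hij : i + j = n), incl K L i j n hij ≫ f = incl K L i j n hij ≫ g) : f = g :=
  mapBifunctor.hom_ext h

/-- The map out of `(K ⊗ L)_n = ⨁_{i + j = n} K_i ⊗ L_j` with given components. -/
noncomputable def desc {K L : ChNN R} {n : ℕ} {A : ModuleCat.{u} R}
    (f : ∀ i j : ℕ, i + j = n → (K.X i ⊗ L.X j ⟶ A)) : (K ⊗ L).X n ⟶ A :=
  mapBifunctorDesc f

@[simp]
lemma incl_desc {K L : ChNN R} {n : ℕ} {A : ModuleCat.{u} R}
    (f : ∀ i j : ℕ, i + j = n → (K.X i ⊗ L.X j ⟶ A)) (i j : ℕ) (h : i + j = n) :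
    incl K L i j n h ≫ desc f = f i j h := by
  apply ι_mapBifunctorDesc

@[simp]
lemma incl_desc_assoc {K L : ChNN R} {n : ℕ} {A B : ModuleCat.{u} R}
    (f : ∀ i j : ℕ, i + j = n → (K.X i ⊗ L.X j ⟶ A)) (i j : ℕ) (h : i + j = n) (g : A ⟶ B) :
    incl K L i j n h ≫ desc f ≫ g = f i j h ≫ g := by
  rw [← Category.assoc, incl_desc]

/-- The same inclusion, with value `0` if `i + j ≠ n`. -/
noncomputable def incl₀ (K L : ChNN R) (i j n : ℕ) : K.X i ⊗ L.X j ⟶ (K ⊗ L).X n :=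
  if h : i + j = n then incl K L i j n h else 0

lemma incl_d (K L : ChNN R) (i j n m : ℕ) (h : i + j = n) :
    incl K L i j n h ≫ (K ⊗ L).d n m =
      K.d i (i - 1) ▷ L.X j ≫ incl₀ K L (i - 1) j m +
        (-1 : ℤˣ) ^ i • (K.X i ◁ L.d j (j - 1) ≫ incl₀ K L i (j - 1) m) := by
  have e : (K ⊗ L).d n m = mapBifunctor.D₁ K L (curriedTensor _) (ComplexShape.down ℕ) n m +
    mapBifunctor.D₂ K L (curriedTensor _) (ComplexShape.down ℕ) n m := rfl
  have h1 : mapBifunctor.d₁ K L (curriedTensor _) (ComplexShape.down ℕ) i j m =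
      K.d i (i - 1) ▷ L.X j ≫ incl₀ K L (i - 1) j m := by
    obtain _ | i := i
    · rw [mapBifunctor.d₁_eq_zero _ _ _ _ _ _ _ (by simp), K.shape _ _ (by simp)]
      simp
    · rw [mapBifunctor.d₁_eq' K L (curriedTensor _) (ComplexShape.down ℕ) (i₁ := i+1) (i₁' := i) (by simp)]
      exact one_smul _ _
  have h2 : mapBifunctor.d₂ K L (curriedTensor _) (ComplexShape.down ℕ) i j m =
      (-1 : ℤˣ) ^ i • (K.X i ◁ L.d j (j - 1) ≫ incl₀ K L i (j - 1) m) := by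
    obtain _ | j := j
    · rw [mapBifunctor.d₂_eq_zero _ _ _ _ _ _ _ (by simp), L.shape _ _ (by simp)]
      simp
    · rw [mapBifunctor.d₂_eq' K L (curriedTensor _) (ComplexShape.down ℕ) i (i₂ := j+1) (i₂' := j) (by simp)]
      rfl
  rw [e, Preadditive.comp_add, ← h1, ← h2]
  congr 1
  · exact mapBifunctor.ι_D₁ ..
  · exact mapBifunctor.ι_D₂ ..

lemma incl_d_assoc (K L : ChNN R) (i j n m : ℕ) (h : i + j = n) {A : ModuleCat.{u} R}
    (g : (K ⊗ L).X m ⟶ A) :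
    incl K L i j n h ≫ (K ⊗ L).d n m ≫ g =
      (K.d i (i - 1) ▷ L.X j ≫ incl₀ K L (i - 1) j m +
        (-1 : ℤˣ) ^ i • (K.X i ◁ L.d j (j - 1) ≫ incl₀ K L i (j - 1) m)) ≫ g := by
  rw [← Category.assoc, incl_d]

@[simp]
lemma incl_whiskerRight {K K' : ChNN R} (f : K ⟶ K') (L : ChNN R) (i j n : ℕ) (h : i + j = n) :
    incl K L i j n h ≫ (f ▷ L).f n = f.f i ▷ L.X j ≫ incl K' L i j n h := by
  have := ι_mapBifunctorMap f (𝟙 L) (curriedTensor _) (ComplexShape.down ℕ) i j n h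
  refine this.trans ?_
  simp
  rfl

@[simp]
lemma incl_whiskerRight_assoc {K K' : ChNN R} (f : K ⟶ K') (L : ChNN R) (i j n : ℕ) (h : i + j = n)
    {A : ModuleCat.{u} R} (g : (K' ⊗ L).X n ⟶ A) :
    incl K L i j n h ≫ (f ▷ L).f n ≫ g = f.f i ▷ L.X j ≫ incl K' L i j n h ≫ g := by
  rw [← Category.assoc, incl_whiskerRight, Category.assoc]

@[simp]
lemma incl_whiskerLeft (K : ChNN R) {L L' : ChNN R} (f : L ⟶ L') (i j n : ℕ) (h : i + j = n) :
    incl K L i j n h ≫ (K ◁ f).f n = K.X i ◁ f.f j ≫ incl K L' i j n h := by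
  have := ι_mapBifunctorMap (𝟙 K) f (curriedTensor _) (ComplexShape.down ℕ) i j n h
  refine this.trans ?_
  simp
  rfl

@[simp]
lemma incl_whiskerLeft_assoc (K : ChNN R) {L L' : ChNN R} (f : L ⟶ L') (i j n : ℕ) (h : i + j = n)
    {A : ModuleCat.{u} R} (g : (K ⊗ L').X n ⟶ A) :
    incl K L i j n h ≫ (K ◁ f).f n ≫ g = K.X i ◁ f.f j ≫ incl K L' i j n h ≫ g := by
  rw [← Category.assoc, incl_whiskerLeft, Category.assoc]

lemma braidingX_braidingX (K L : ChNN R) (n : ℕ) :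
  desc (fun i j h => (-1 : ℤˣ) ^ (i * j) • ((β_ (K.X i) (L.X j)).hom ≫
      incl L K j i n ((add_comm j i).trans h))) ≫ 
   desc (fun i j h => (-1 : ℤˣ) ^ (i * j) • ((β_ (L.X i) (K.X j)).hom ≫
      incl K L j i n ((add_comm j i).trans h))) = 𝟙 _ := by
  apply tensor_hom_ext
  intro i j h
  rw [incl_desc_assoc]
  simp [smul_smul, mul_comm j i]

/-- The braiding in degree `n`: `x ⊗ y ↦ (-1)^(i j) y ⊗ x` for `x` of degree `i` and `y` of
degree `j`. -/
noncomputable def braidingX (K L : ChNN R) (n : ℕ) : (K ⊗ L).X n ≅ (L ⊗ K).X n where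
  hom := desc (fun i j h => (-1 : ℤˣ) ^ (i * j) • ((β_ (K.X i) (L.X j)).hom ≫
      incl L K j i n ((add_comm j i).trans h)))
  inv := desc (fun i j h => (-1 : ℤˣ) ^ (i * j) • ((β_ (L.X i) (K.X j)).hom ≫
      incl K L j i n ((add_comm j i).trans h)))
  hom_inv_id := braidingX_braidingX K L n
  inv_hom_id := braidingX_braidingX L K n

@[simp]
lemma incl_braidingX (K L : ChNN R) (i j n : ℕ) (h : i + j = n) :
    incl K L i j n h ≫ (braidingX K L n).hom = (-1 : ℤˣ) ^ (i * j) • ((β_ (K.X i) (L.X j)).hom ≫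
      incl L K j i n ((add_comm j i).trans h)) := by
  exact incl_desc _ _ _ _

lemma incl_braidingX_assoc (K L : ChNN R) (i j n : ℕ) (h : i + j = n) {A : ModuleCat.{u} R}
    (g : (L ⊗ K).X n ⟶ A) :
    incl K L i j n h ≫ (braidingX K L n).hom ≫ g = ((-1 : ℤˣ) ^ (i * j) •
      ((β_ (K.X i) (L.X j)).hom ≫ incl L K j i n ((add_comm j i).trans h))) ≫ g := by
  rw [← Category.assoc, incl_braidingX]

lemma incl₀_braidingX (K L : ChNN R) (i j n : ℕ) :
    incl₀ K L i j n ≫ (braidingX K L n).hom = (-1 : ℤˣ) ^ (i * j) • ((β_ (K.X i) (L.X j)).hom ≫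
      incl₀ L K j i n) := by
  unfold incl₀
  by_cases h : i + j = n
  · have h' : j + i = n := by omega
    simp [h, h']
  · have h' : ¬ j + i = n := by omega
    simp [h, h']

/-- The Koszul braiding `K ⊗ L ≅ L ⊗ K`, `x ⊗ y ↦ (-1)^(|x| |y|) y ⊗ x`. -/
noncomputable def braid (K L : ChNN R) : K ⊗ L ≅ L ⊗ K :=
  HomologicalComplex.Hom.isoOfComponents (braidingX K L) (by
    intro n m _
    apply tensor_hom_ext
    intro i j h
    rw [incl_d_assoc]
    have e₁ : (-1 : ℤˣ) ^ (i * j) • (K.X i ◁ L.d j (j - 1)) =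
        ((-1 : ℤˣ) ^ i * (-1 : ℤˣ) ^ (i * (j - 1))) • (K.X i ◁ L.d j (j - 1)) := by
      obtain _ | j := j
      · rw [L.shape _ _ (by simp)]; simp
      · rw [← pow_add]; congr 2; simp; ring
    have e₂ : ((-1 : ℤˣ) ^ (i * j) * (-1 : ℤˣ) ^ j) • (K.d i (i - 1) ▷ L.X j) =
        (-1 : ℤˣ) ^ ((i - 1) * j) • (K.d i (i - 1) ▷ L.X j) := by
      obtain _ | i := i
      · rw [K.shape _ _ (by simp)]; simp
      · rw [← pow_add, show (i + 1) * j + j = i * j + 2 * j by ring, pow_add, pow_mul _ 2]; simp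
    simp only [Preadditive.add_comp, Category.assoc, Linear.units_smul_comp, incl₀_braidingX, incl_d,
      Preadditive.comp_add, smul_add, Linear.comp_units_smul, smul_smul, incl_braidingX_assoc, ← BraidedCategory.braiding_naturality_left_assoc,
      ← BraidedCategory.braiding_naturality_right_assoc]
    simp only [← Linear.units_smul_comp, e₁, e₂]
    rw [add_comm])

@[simp]
lemma incl_braid_hom (K L : ChNN R) (i j n : ℕ) (h : i + j = n) :
    incl K L i j n h ≫ (braid K L).hom.f n = (-1 : ℤˣ) ^ (i * j) • ((β_ (K.X i) (L.X j)).hom ≫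
      incl L K j i n ((add_comm j i).trans h)) := by
  simp [braid]

@[simp]
lemma incl_braid_hom_assoc (K L : ChNN R) (i j n : ℕ) (h : i + j = n) {A : ModuleCat.{u} R}
    (g : (L ⊗ K).X n ⟶ A) :
    incl K L i j n h ≫ (braid K L).hom.f n ≫ g = ((-1 : ℤˣ) ^ (i * j) •
      ((β_ (K.X i) (L.X j)).hom ≫ incl L K j i n ((add_comm j i).trans h))) ≫ g := by
  rw [← Category.assoc, incl_braid_hom]

lemma incl_assoc (X Y Z : ChNN R) (i j k s t n : ℕ) (hs : i + j = s) (hn : s + k = n)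
    (ht : j + k = t) (hn' : i + t = n) :
    (incl X Y i j s hs ▷ Z.X k) ≫ incl (X ⊗ Y) Z s k n hn ≫ (α_ X Y Z).hom.f n =
      (α_ (X.X i) (Y.X j) (Z.X k)).hom ≫ (X.X i ◁ incl Y Z j k t ht) ≫ incl X (Y ⊗ Z) i t n hn' := by
  have h1 := ι_mapBifunctorAssociatorX_hom (curriedAssociatorNatIso (ModuleCat.{u} R)) X Y Z
    (ComplexShape.down ℕ) (ComplexShape.down ℕ) (ComplexShape.down ℕ) i j k n
      (by subst hs; exact hn)
  rw [mapBifunctor₁₂.ι_eq _ _ _ _ _ _ _ i j k s n hs hn,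
    mapBifunctor₂₃.ι_eq _ _ _ _ _ _ _ _ i j k t n ht hn', Category.assoc] at h1
  exact h1

lemma incl_assoc_assoc (X Y Z : ChNN R) (i j k s t n : ℕ) (hs : i + j = s) (hn : s + k = n)
    (ht : j + k = t) (hn' : i + t = n) {A : ModuleCat.{u} R} (g : (X ⊗ (Y ⊗ Z)).X n ⟶ A) :
    (incl X Y i j s hs ▷ Z.X k) ≫ incl (X ⊗ Y) Z s k n hn ≫ (α_ X Y Z).hom.f n ≫ g =
      (α_ (X.X i) (Y.X j) (Z.X k)).hom ≫ (X.X i ◁ incl Y Z j k t ht) ≫ incl X (Y ⊗ Z) i t n hn' ≫ g := by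
  have h := congrArg (· ≫ g) (incl_assoc X Y Z i j k s t n hs hn ht hn')
  simpa only [Category.assoc] using h

lemma tensor₃_hom_ext {X Y Z : ChNN R} {n : ℕ} {A : ModuleCat.{u} R}
    {f g : ((X ⊗ Y) ⊗ Z).X n ⟶ A}
    (h : ∀ (i j k : ℕ) (hn : i + j + k = n),
      (incl X Y i j (i + j) rfl ▷ Z.X k) ≫ incl (X ⊗ Y) Z (i + j) k n hn ≫ f =
      (incl X Y i j (i + j) rfl ▷ Z.X k) ≫ incl (X ⊗ Y) Z (i + j) k n hn ≫ g) : f = g := by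
  apply mapBifunctor₁₂.hom_ext
  intro i j k hn
  rw [mapBifunctor₁₂.ι_eq _ _ _ _ _ _ _ i j k (i + j) n rfl hn, Category.assoc, Category.assoc]
  exact h i j k hn

lemma units_smul_whiskerRight {A B : ModuleCat.{u} R} (c : ℤˣ) (f : A ⟶ B) (C : ModuleCat.{u} R) :
    (c • f) ▷ C = c • (f ▷ C) := by
  rcases Int.units_eq_one_or c with rfl | rfl
  · simp
  · rw [Units.neg_smul, one_smul, Units.neg_smul, one_smul]
    exact (tensorRight C).map_neg

lemma whiskerLeft_units_smul {A B : ModuleCat.{u} R} (c : ℤˣ) (f : A ⟶ B) (C : ModuleCat.{u} R) :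
    C ◁ (c • f) = c • (C ◁ f) := by
  rcases Int.units_eq_one_or c with rfl | rfl
  · simp
  · rw [Units.neg_smul, one_smul, Units.neg_smul, one_smul]
    exact (tensorLeft C).map_neg

lemma braid_naturality_right (X : ChNN R) {Y Z : ChNN R} (f : Y ⟶ Z) :
    X ◁ f ≫ (braid X Z).hom = (braid X Y).hom ≫ f ▷ X := by
  ext n : 1
  apply tensor_hom_ext
  intro i j h
  simp

lemma braid_symm (X Y : ChNN R) : (braid X Y).hom ≫ (braid Y X).hom = 𝟙 _ := by
  ext n : 1
  apply tensor_hom_ext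
  intro i j h
  simp [smul_smul, mul_comm j i]

lemma braid_naturality_left {X Y : ChNN R} (f : X ⟶ Y) (Z : ChNN R) :
    f ▷ Z ≫ (braid Y Z).hom = (braid X Z).hom ≫ Z ◁ f := by
  ext n : 1
  apply tensor_hom_ext
  intro i j h
  simp

lemma hexagon_fwd (X Y Z : ChNN R) : (α_ X Y Z).hom ≫ (braid X (Y ⊗ Z)).hom ≫ (α_ Y Z X).hom =
   ((braid X Y).hom ▷ Z) ≫ (α_ Y X Z).hom ≫ (Y ◁ (braid X Z).hom) := by
  ext n : 1
  apply tensor₃_hom_ext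
  intro i j k h
  simp only [comp_f]
  rw [incl_assoc_assoc _ _ _ _ _ _ _ (j + k) _ _ _ rfl (by omega), incl_braid_hom_assoc]
  rw [incl_whiskerRight_assoc, ← comp_whiskerRight_assoc, incl_braid_hom]
  simp only [Linear.units_smul_comp, Linear.comp_units_smul, Category.assoc, units_smul_whiskerRight,
    comp_whiskerRight, BraidedCategory.braiding_naturality_right_assoc]
  rw [incl_assoc Y Z X j k i (j + k) (i + k) n rfl (by omega) (by omega) (by omega),
    incl_assoc_assoc Y X Z j i k (i + j) (i + k) n (by omega) (by omega) rfl (by omega),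
    incl_whiskerLeft, ← MonoidalCategory.whiskerLeft_comp_assoc (Y.X j), incl_braid_hom]
  simp only [whiskerLeft_units_smul, Linear.units_smul_comp, Linear.comp_units_smul, Category.assoc,
    MonoidalCategory.whiskerLeft_comp, smul_smul]
  rw [mul_add, pow_add, BraidedCategory.hexagon_forward_assoc]

/-- Non-negatively graded chain complexes form a symmetric monoidal category, with Mathlib's tensor
product `d(x ⊗ y) = dx ⊗ y + (-1)^|x| x ⊗ dy` and the Koszul braiding. -/
noncomputable instance : SymmetricCategory (ChNN R) where
  braiding := braid
  braiding_naturality_right := braid_naturality_right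
  braiding_naturality_left := braid_naturality_left
  hexagon_forward := hexagon_fwd
  hexagon_reverse X Y Z := by
    have h : α_ Z X Y ≪≫ braid Z (X ⊗ Y) ≪≫ α_ X Y Z =
        whiskerRightIso (braid Z X) Y ≪≫ α_ X Z Y ≪≫ whiskerLeftIso X (braid Z Y) :=
      Iso.ext (hexagon_fwd Z X Y)
    have e (A B : ChNN R) : (braid A B).inv = (braid B A).hom := (Iso.inv_ext (braid_symm A B))
    simpa [e] using congrArg Iso.inv h
  symmetry := braid_symm



/-- The formula `(df)(x) = d(f(x)) - (-1)^n f(dx)` for the differential of the hom complex in degree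
`n`, for families `f p q : X_p → Y_q`; the component `(p, q)` of `df` involves the components
`(p, q + 1)` and `(p - 1, q)` of `f`, the latter only if `p > 0` as `X.d 0 (0 - 1) = 0`. -/
def homD (X Y : ChNN R) (n : ℕ) : ((p q : ℕ) → (X.X p →ₗ[R] Y.X q)) →ₗ[R] ((p q : ℕ) → (X.X p →ₗ[R] Y.X q)) where
  toFun f p q := (Y.d (q + 1) q).hom ∘ₗ f p (q + 1) - (-1 : R) ^ n • (f (p - 1) q ∘ₗ (X.d p (p - 1)).hom)
  map_add' f g := by
    ext p q x
    simp [LinearMap.add_apply, smul_add]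
    abel
  map_smul' a f := by
    ext p q x
    simp [smul_sub, smul_comm a ((-1 : R) ^ n)]

lemma homD_homD (X Y : ChNN R) (n : ℕ) (f : (p q : ℕ) → (X.X p →ₗ[R] Y.X q)) :
    homD X Y n (homD X Y (n + 1) f) = 0 := by
  ext p q x
  have h1 : ∀ y, (Y.d (q + 1) q).hom ((Y.d (q + 1 + 1) (q + 1)).hom y) = 0 := fun y => by
    rw [← LinearMap.comp_apply, ← ModuleCat.hom_comp, Y.d_comp_d]; rfl
  have h2 : (X.d (p - 1) (p - 1 - 1)).hom ((X.d p (p - 1)).hom x) = 0 := by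
    rw [← LinearMap.comp_apply, ← ModuleCat.hom_comp, X.d_comp_d]; rfl
  simp [homD, h1, h2, pow_succ]

/-- The degree `n` part of the hom complex: families of linear maps `X_p → Y_(p+n)` if `n > 0`, that
is `∏_p Hom(X_p, Y_(p+n))`, and the cycles among them (the chain maps) if `n = 0`. This is the good
truncation in degrees `≥ 0` of the unbounded hom complex. -/
def homSubmodule (X Y : ChNN R) (n : ℕ) : Submodule R ((p q : ℕ) → (X.X p →ₗ[R] Y.X q)) where
  carrier := {f | (∀ p q, p + n ≠ q → f p q = 0) ∧ (n = 0 → homD X Y 0 f = 0)}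
  add_mem' := by
    rintro f g ⟨hf, hf'⟩ ⟨hg, hg'⟩
    exact ⟨fun p q h => by simp [hf p q h, hg p q h], fun h => by simp [hf' h, hg' h]⟩
  zero_mem' := by simp
  smul_mem' := by
    rintro a f ⟨hf, hf'⟩
    exact ⟨fun p q h => by simp [hf p q h], fun h => by simp [hf' h]⟩

lemma homD_mem (X Y : ChNN R) (n : ℕ) (f : (p q : ℕ) → (X.X p →ₗ[R] Y.X q))
    (hf : f ∈ homSubmodule X Y (n + 1)) : homD X Y (n + 1) f ∈ homSubmodule X Y n := by
  refine ⟨fun p q h => ?_, ?_⟩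
  · have h1 : f p (q + 1) = 0 := hf.1 _ _ (by omega)
    obtain _ | p := p
    · simp [homD, h1]
    · have h2 : f p q = 0 := hf.1 _ _ (by omega)
      simp [homD, h1, h2]
  · rintro rfl
    exact homD_homD X Y 0 f

/-- The internal hom `Hom(X, Y)` of non-negatively graded chain complexes. -/
noncomputable def homComplex (X Y : ChNN R) : ChNN R :=
  ChainComplex.of (fun n => ModuleCat.of R (homSubmodule X Y n))
    (fun n => ModuleCat.ofHom ((homD X Y (n + 1)).restrict (homD_mem X Y n)))
    (fun n => by
      ext f : 2
      exact Subtype.ext (homD_homD X Y (n + 1) f.1))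

/-- An element of degree `n` of the hom complex, as a family of linear maps. -/
noncomputable def homVal (X Y : ChNN R) (n : ℕ) :
    (homComplex X Y).X n →ₗ[R] ((p q : ℕ) → (X.X p →ₗ[R] Y.X q)) :=
  (homSubmodule X Y n).subtype

lemma homVal_injective (X Y : ChNN R) (n : ℕ) : Function.Injective (homVal X Y n) :=
  Subtype.val_injective

lemma homVal_mem (X Y : ChNN R) (n : ℕ) (f : (homComplex X Y).X n) :
    homVal X Y n f ∈ homSubmodule X Y n := f.2

lemma homVal_d (X Y : ChNN R) (n : ℕ) (f : (homComplex X Y).X (n + 1)) :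
    homVal X Y n ((homComplex X Y).d (n + 1) n f) = homD X Y (n + 1) (homVal X Y (n + 1) f) := by
  have h : (homComplex X Y).d (n + 1) n =
    ModuleCat.ofHom ((homD X Y (n + 1)).restrict (homD_mem X Y n)) :=
      ChainComplex.of_d (fun n => ModuleCat.of R (homSubmodule X Y n))
        (fun n => ModuleCat.ofHom ((homD X Y (n + 1)).restrict (homD_mem X Y n))) n
  rw [h]
  rfl

lemma incl₀_d (K L : ChNN R) (i j q : ℕ) :
    incl₀ K L i j (q + 1) ≫ (K ⊗ L).d (q + 1) q =
      K.d i (i - 1) ▷ L.X j ≫ incl₀ K L (i - 1) j q +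
        (-1 : ℤˣ) ^ i • (K.X i ◁ L.d j (j - 1) ≫ incl₀ K L i (j - 1) q) := by
  by_cases h : i + j = q + 1
  · rw [← incl_d K L i j (q + 1) q h, incl₀, dif_pos h]
  · have e₁ : K.d i (i - 1) ▷ L.X j ≫ incl₀ K L (i - 1) j q = 0 := by
      obtain _ | i := i
      · rw [K.shape _ _ (by simp)]; simp
      · rw [incl₀, dif_neg (by omega), comp_zero]
    have e₂ : K.X i ◁ L.d j (j - 1) ≫ incl₀ K L i (j - 1) q = 0 := by
      obtain _ | j := j
      · rw [L.shape _ _ (by simp)]; simp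
      · rw [incl₀, dif_neg (by omega), comp_zero]
    rw [e₁, e₂, incl₀, dif_neg h]
    simp

lemma units_pow_smul_hom {A B : ModuleCat.{u} R} (n : ℕ) (f : A ⟶ B) (a : A) :
    ((-1 : ℤˣ) ^ n • f).hom a = (-1 : R) ^ n • f.hom a := by
  obtain h | h := n.even_or_odd
  · simp [h.neg_one_pow]
  · rw [h.neg_one_pow, h.neg_one_pow, Units.neg_smul, one_smul, neg_one_smul]
    rfl

/-- The bilinear map `(k, x) ↦ g (x ⊗ k)`, for `x` in degree `p`, `k` in degree `n` and values in
degree `q`; it is `0` if `p + n ≠ q`. -/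
noncomputable def pairing {X K Y : ChNN R} (g : X ⊗ K ⟶ Y) (p n q : ℕ) :
    K.X n →ₗ[R] X.X p →ₗ[R] Y.X q :=
  ((TensorProduct.mk R (X.X p) (K.X n)).compr₂ (incl₀ X K p n q ≫ g.f q).hom).flip

lemma d_pairing {X K Y : ChNN R} (g : X ⊗ K ⟶ Y) (p n q : ℕ) (x : X.X p) (k : K.X n) :
    Y.d (q + 1) q (pairing g p n (q + 1) k x) =
      pairing g (p - 1) n q k (X.d p (p - 1) x) +
        (-1 : R) ^ p • pairing g p (n - 1) q (K.d n (n - 1) k) x := by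
  have h := congrArg (· ≫ g.f q) (incl₀_d X K p n q)
  simp only [Category.assoc, ← g.comm] at h
  rw [← Category.assoc] at h
  have h' := LinearMap.congr_fun (congrArg ModuleCat.Hom.hom h) (x ⊗ₜ[R] k)
  refine h'.trans ?_
  simp only [Preadditive.add_comp, Category.assoc, Linear.units_smul_comp, ModuleCat.hom_add,
    LinearMap.add_apply, units_pow_smul_hom]
  rfl

/-- The family of linear maps `x ↦ (-1)^(|x| |k|) g (x ⊗ k)`. -/
noncomputable def curryFun {X K Y : ChNN R} (g : X ⊗ K ⟶ Y) (n : ℕ) :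
    K.X n →ₗ[R] (p q : ℕ) → (X.X p →ₗ[R] Y.X q) :=
  LinearMap.pi fun p => LinearMap.pi fun q => (-1 : R) ^ (p * n) • pairing g p n q

lemma curryFun_apply {X K Y : ChNN R} (g : X ⊗ K ⟶ Y) (n : ℕ) (k : K.X n) (p q : ℕ) :
    curryFun g n k p q = (-1 : R) ^ (p * n) • pairing g p n q k := rfl

lemma homD_curryFun {X K Y : ChNN R} (g : X ⊗ K ⟶ Y) (n : ℕ) (k : K.X n) :
    homD X Y n (curryFun g n k) = curryFun g (n - 1) (K.d n (n - 1) k) := by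
  funext p q
  ext x
  change Y.d (q + 1) q ((-1 : R) ^ (p * n) • pairing g p n (q + 1) k x) -
    (-1 : R) ^ n • (-1 : R) ^ ((p - 1) * n) • pairing g (p - 1) n q k (X.d p (p - 1) x) =
    (-1 : R) ^ (p * (n - 1)) • pairing g p (n - 1) q (K.d n (n - 1) k) x
  rw [map_smul, d_pairing]
  have e₁ : (-1 : R) ^ (p * n) • pairing g (p - 1) n q k (X.d p (p - 1) x) =
      (-1 : R) ^ n • (-1 : R) ^ ((p - 1) * n) • pairing g (p - 1) n q k (X.d p (p - 1) x) := by
    obtain _ | p := p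
    · rw [X.shape _ _ (by simp)]; simp
    · rw [smul_smul, ← pow_add]; congr 2; simp; ring
  have e₂ : (-1 : R) ^ (p * n) • (-1 : R) ^ p • pairing g p (n - 1) q (K.d n (n - 1) k) x =
      (-1 : R) ^ (p * (n - 1)) • pairing g p (n - 1) q (K.d n (n - 1) k) x := by
    obtain _ | n := n
    · rw [K.shape _ _ (by simp)]; simp
    · rw [smul_smul, ← pow_add, show p * (n + 1) + p = p * n + 2 * p by ring, pow_add, pow_mul _ 2]
      simp
  rw [smul_add, e₁, e₂, add_sub_cancel_left]

lemma curryFun_mem {X K Y : ChNN R} (g : X ⊗ K ⟶ Y) (n : ℕ) (k : K.X n) :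
    curryFun g n k ∈ homSubmodule X Y n := by
  constructor
  · intro p q h
    ext x
    simp [curryFun_apply, pairing, incl₀, h]
  · rintro rfl
    rw [homD_curryFun, K.shape _ _ (by simp)]
    simp

/-- The chain map `K ⟶ Hom(X, Y)` adjoint to `g : X ⊗ K ⟶ Y`: it sends `k` to
`x ↦ (-1)^(|x| |k|) g (x ⊗ k)`. -/
noncomputable def curry {X K Y : ChNN R} (g : X ⊗ K ⟶ Y) : K ⟶ homComplex X Y where
  f n := ModuleCat.ofHom ((curryFun g n).codRestrict (homSubmodule X Y n) (curryFun_mem g n))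
  comm' := by
    rintro _ n rfl
    ext k
    apply homVal_injective
    exact (homVal_d _ _ _ _).trans (homD_curryFun g (n + 1) k)

lemma homVal_curry {X K Y : ChNN R} (g : X ⊗ K ⟶ Y) (n : ℕ) (k : K.X n) :
    homVal X Y n ((curry g).f n k) = curryFun g n k := rfl

/-- The bilinear map `(k, x) ↦ φ(k)(x)`. -/
noncomputable def uncurryPairing {X K Y : ChNN R} (φ : K ⟶ homComplex X Y) (p n q : ℕ) :
    K.X n →ₗ[R] X.X p →ₗ[R] Y.X q :=
  LinearMap.proj q ∘ₗ LinearMap.proj p ∘ₗ homVal X Y n ∘ₗ (φ.f n).hom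

/-- Degreewise description of `uncurry`. -/
noncomputable def uncurryX {X K Y : ChNN R} (φ : K ⟶ homComplex X Y) (q : ℕ) : (X ⊗ K).X q ⟶ Y.X q :=
  desc fun p n _ =>
    ModuleCat.ofHom ((-1 : R) ^ (p * n) • TensorProduct.lift (uncurryPairing φ p n q).flip)

lemma incl₀_uncurryX {X K Y : ChNN R} (φ : K ⟶ homComplex X Y) (p n q : ℕ) (x : X.X p) (k : K.X n) :
    (incl₀ X K p n q ≫ uncurryX φ q).hom (x ⊗ₜ[R] k) = 
      (-1 : R) ^ (p * n) • uncurryPairing φ p n q k x := by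
  by_cases h : p + n = q
  · rw [incl₀, dif_pos h, uncurryX, incl_desc]
    rfl
  · have : uncurryPairing φ p n q k = 0 := (homVal_mem X Y n _).1 p q h
    rw [incl₀, dif_neg h, this]
    simp

lemma d_uncurryPairing {X K Y : ChNN R} (φ : K ⟶ homComplex X Y) (p n q : ℕ) (x : X.X p) (k : K.X n) :
    uncurryPairing φ p (n - 1) q (K.d n (n - 1) k) x = 
      Y.d (q + 1) q (uncurryPairing φ p n (q + 1) k x) -
        (-1 : R) ^ n • uncurryPairing φ (p - 1) n q k (X.d p (p - 1) x) := by
  have h : homVal X Y (n - 1) (φ.f (n - 1) (K.d n (n - 1) k)) =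
      homD X Y n (homVal X Y n (φ.f n k)) := by
    obtain _ | n := n
    · rw [K.shape _ _ (by simp), (homVal_mem X Y 0 _).2 rfl]
      simp
    · rw [← homVal_d]
      congr 1
      exact (LinearMap.congr_fun (congrArg ModuleCat.Hom.hom (φ.comm (n + 1) n)) k).symm
  exact LinearMap.congr_fun (congr_fun (congr_fun h p) q) x

/-- The chain map `X ⊗ K ⟶ Y` adjoint to `φ : K ⟶ Hom(X, Y)`: it sends `x ⊗ k` to
`(-1)^(|x| |k|) φ(k)(x)`. -/
noncomputable def uncurry {X K Y : ChNN R} (φ : K ⟶ homComplex X Y) : X ⊗ K ⟶ Y where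
  f q := uncurryX φ q
  comm' := by
    rintro _ q rfl
    apply tensor_hom_ext
    intro p n h
    rw [incl_d_assoc]
    ext : 1
    apply TensorProduct.ext'
    intro x k
    have h1 : (incl X K p n (q + 1) h ≫ uncurryX φ (q + 1)).hom (x ⊗ₜ[R] k) =
      (-1 : R) ^ (p * n) • uncurryPairing φ p n (q + 1) k x := by
      have := incl₀_uncurryX φ p n (q + 1) x k
      rwa [incl₀, dif_pos h] at this
    have e₁ : (-1 : R) ^ (p * n) • (-1 : R) ^ n • uncurryPairing φ (p - 1) n q k (X.d p (p - 1) x) =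
        (-1 : R) ^ ((p - 1) * n) • uncurryPairing φ (p - 1) n q k (X.d p (p - 1) x) := by
      obtain _ | p := p
      · rw [X.shape _ _ (by simp)]; simp
      · rw [smul_smul, ← pow_add, show (p + 1) * n + n = p * n + 2 * n by ring, pow_add,
          pow_mul _ 2]
        simp
    have e₂ : (-1 : R) ^ p • (-1 : R) ^ (p * (n - 1)) •
        uncurryPairing φ p (n - 1) q (K.d n (n - 1) k) x =
        (-1 : R) ^ (p * n) • uncurryPairing φ p (n - 1) q (K.d n (n - 1) k) x := by
      obtain _ | n := n
      · rw [K.shape _ _ (by simp)]; simp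
      · rw [smul_smul, ← pow_add]; congr 2; simp; ring
    have h2 : (-1 : R) ^ (p * n) • Y.d (q + 1) q (uncurryPairing φ p n (q + 1) k x) =
        (-1 : R) ^ ((p - 1) * n) • uncurryPairing φ (p - 1) n q k (X.d p (p - 1) x) +
        (-1 : R) ^ p • (-1 : R) ^ (p * (n - 1)) •
          uncurryPairing φ p (n - 1) q (K.d n (n - 1) k) x := by
      rw [e₂, d_uncurryPairing, smul_sub, e₁]
      abel
    simp only [Preadditive.add_comp, Category.assoc, Linear.units_smul_comp, ModuleCat.hom_add,
      LinearMap.add_apply]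
    refine Eq.trans ?_ (h2.trans ?_)
    · rw [← map_smul, ← h1]
      rfl
    · rw [← incl₀_uncurryX, ← incl₀_uncurryX]
      congr 1
      exact (units_pow_smul_hom p (X.X p ◁ K.d n (n - 1) ≫ incl₀ X K p (n - 1) q ≫ uncurryX φ q)
        (x ⊗ₜ[R] k)).symm

lemma pairing_uncurry {X K Y : ChNN R} (φ : K ⟶ homComplex X Y) (p n q : ℕ) (x : X.X p) (k : K.X n) :
    pairing (uncurry φ) p n q k x = (-1 : R) ^ (p * n) • uncurryPairing φ p n q k x :=
  incl₀_uncurryX φ p n q x k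

lemma curry_uncurry {X K Y : ChNN R} (φ : K ⟶ homComplex X Y) : curry (uncurry φ) = φ := by
  ext n k
  apply homVal_injective
  funext p q
  ext x
  change (-1 : R) ^ (p * n) • pairing (uncurry φ) p n q k x = uncurryPairing φ p n q k x
  rw [pairing_uncurry, smul_smul, ← mul_pow]
  simp

lemma hom_ext_pairing {X K Y : ChNN R} {g h : X ⊗ K ⟶ Y}
    (H : ∀ p n q k x, pairing g p n q k x = pairing h p n q k x) : g = h := by
  ext q : 1
  apply tensor_hom_ext
  intro p n e
  ext : 1
  apply TensorProduct.ext'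
  intro x k
  have := H p n q k x
  simpa [pairing, incl₀, e] using this

lemma uncurry_curry {X K Y : ChNN R} (g : X ⊗ K ⟶ Y) : uncurry (curry g) = g := by
  apply hom_ext_pairing
  intro p n q k x
  rw [pairing_uncurry]
  change (-1 : R) ^ (p * n) • (-1 : R) ^ (p * n) • pairing g p n q k x = _
  rw [smul_smul, ← mul_pow]
  simp

lemma homD_postcomp (X : ChNN R) {Y Y' : ChNN R} (g : Y ⟶ Y') (n : ℕ)
    (f : (p q : ℕ) → (X.X p →ₗ[R] Y.X q)) :
    homD X Y' n (fun p q => (g.f q).hom ∘ₗ f p q) = fun p q => (g.f q).hom ∘ₗ homD X Y n f p q := by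
  funext p q
  ext x
  have h := LinearMap.congr_fun (congrArg ModuleCat.Hom.hom (g.comm (q + 1) q)) (f p (q + 1) x)
  change Y'.d (q + 1) q (g.f (q + 1) (f p (q + 1) x)) - (-1 : R) ^ n • g.f q (f (p - 1) q _) =
    g.f q (Y.d (q + 1) q (f p (q + 1) x) - (-1 : R) ^ n • f (p - 1) q _)
  rw [map_sub, map_smul]
  congr 1

/-- The functor `Hom(X, -)`. -/
noncomputable def homFunctor (X : ChNN R) : ChNN R ⥤ ChNN R where
  obj Y := homComplex X Y
  map {Y Y'} g :=
    { f := fun n => ModuleCat.ofHom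
        { toFun := fun f => ⟨fun p q => (g.f q).hom ∘ₗ homVal X Y n f p q, by
            have h := homVal_mem X Y n f
            refine ⟨fun p q e => by
              change (g.f q).hom ∘ₗ homVal X Y n f p q = 0
              rw [h.1 p q e, LinearMap.comp_zero], ?_⟩
            rintro rfl
            rw [homD_postcomp, h.2 rfl]
            funext p q
            exact LinearMap.comp_zero _⟩
          map_add' := fun f f' => by
            apply Subtype.ext
            funext p q
            exact LinearMap.comp_add _ _ _
          map_smul' := fun a f => by
            apply Subtype.ext
            funext p q
            exact LinearMap.comp_smul _ _ _ }
      comm' := by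
        rintro _ n rfl
        ext f
        apply homVal_injective
        refine (homVal_d _ _ _ _).trans ((homD_postcomp X g (n + 1) _).trans ?_)
        rw [← homVal_d]
        rfl }
  map_id Y := rfl
  map_comp f g := rfl

/-- The adjunction `X ⊗ - ⊣ Hom(X, -)`. -/
noncomputable def tensorHomAdj (X : ChNN R) : tensorLeft X ⊣ homFunctor X :=
  Adjunction.mkOfHomEquiv
    { homEquiv := fun K Y => ⟨curry, uncurry, uncurry_curry, curry_uncurry⟩
      homEquiv_naturality_left_symm := by
        intro K K' Y f φ
        apply hom_ext_pairing
        intro p n q k x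
        refine (pairing_uncurry _ p n q x k).trans ?_
        trans pairing (uncurry φ) p n q (f.f n k) x
        · exact (pairing_uncurry φ p n q x (f.f n k)).symm
        · by_cases e : p + n = q
          · have h := incl_whiskerLeft X f p n q e
            have h' := LinearMap.congr_fun (congrArg ModuleCat.Hom.hom
              (congrArg (· ≫ (uncurry φ).f q) h)) (x ⊗ₜ[R] k)
            simp only [pairing, incl₀, dif_pos e]
            exact h'.symm
          · simp [pairing, incl₀, e]
      homEquiv_naturality_right := by
        intro K Y Y' f g
        ext n k
        apply homVal_injective
        funext p q
        ext x
        exact (map_smul (g.f q).hom ((-1 : R) ^ (p * n)) (pairing f p n q k x)).symm }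

/-- The closed structure given by the hom complex. -/
noncomputable instance : MonoidalClosed (ChNN R) where
  closed X := { rightAdj := homFunctor X, adj := tensorHomAdj X }

end ChNN

namespace ChNN

open EnrichedModel

variable (R : Type u) [CommRing R]

/-- Chain maps whose components in positive degrees are split epimorphisms. -/
def splitEpiPos : MorphismProperty (ChNN R) :=
  fun _ _ f => ∀ n : ℕ, 0 < n → IsSplitEpi (f.f n)

/-- `M` is the projective (Quillen) model structure: weak equivalences are the quasi-isomorphisms,
fibrations the maps which are epimorphisms in positive degrees, cofibrations the degreewise
monomorphisms with degreewise projective cokernel. -/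
structure IsProjectiveModel (M : ModelCategory (ChNN R)) : Prop where
  weq_eq : weq M = quasiIso (ModuleCat.{u} R) (ComplexShape.down ℕ)
  fib_eq : fib M = fun _ _ f => ∀ n : ℕ, 0 < n → Epi (f.f n)
  cof_eq : cof M = fun _ _ f => ∀ n : ℕ, Mono (f.f n) ∧ Projective (cokernel (f.f n))

/-- `M` is the Hurewicz model structure: weak equivalences are the chain homotopy equivalences,
fibrations the maps which are split epimorphisms in positive degrees, cofibrations the degreewise split
monomorphisms. -/
structure IsHurewiczModel (M : ModelCategory (ChNN R)) : Prop where
  weq_eq : weq M = homotopyEquivalences (ModuleCat.{u} R) (ComplexShape.down ℕ)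
  fib_eq : fib M = splitEpiPos R
  cof_eq : cof M = fun _ _ f => ∀ n : ℕ, IsSplitMono (f.f n)

/-- `M` is the mixed model structure: weak equivalences are the quasi-isomorphisms, fibrations the maps
which are split epimorphisms in positive degrees, cofibrations the maps with the left lifting property
with respect to acyclic fibrations. -/
structure IsMixedModel (M : ModelCategory (ChNN R)) : Prop where
  weq_eq : weq M = quasiIso (ModuleCat.{u} R) (ComplexShape.down ℕ)
  fib_eq : fib M = splitEpiPos R
  cof_eq : cof M = (splitEpiPos R ⊓ quasiIso (ModuleCat.{u} R) (ComplexShape.down ℕ)).llp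

variable {R}

open scoped MonoidalClosed in
/-- `Ch_{≥ 0}(R)` with the model structure `MC` is an enriched model category over `Ch_{≥ 0}(R)` with
the model structure `MV`, for its standard self-enrichment: hom objects are the hom complexes, tensors
the tensor products of complexes and cotensors the hom complexes. -/
def EnrichedOver (MC MV : ModelCategory (ChNN R)) : Prop :=
  IsEnrichedModelCategory (selfTensorCotensor (ChNN R)) MV MC

end ChNN

/-! The Hurewicz and mixed structures have the same fibrations, `splitEpiPos`, hence the same
acyclic cofibrations: the class `(splitEpiPos R).llp`, which consists of the degreewise split
monomorphisms that are homotopy equivalences (`hurewicz_llp_eq`). Projective acyclic cofibrations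
also lie in this class, since split epimorphisms are epimorphisms. The acyclicity half of every
pushout-product axiom thus comes from one fact. Tensoring preserves homotopies, so if `i : X ⟶ Y` is
in the class, then so are `i ⊗ V` and its cobase change, while `i ⊗ W` is a homotopy equivalence;
two out of three makes `i □ k` a homotopy equivalence (`homotopyEquivalences_pushoutProduct_left`).

For the cofibration half, choose degreewise complements of `i` and `k`: the sums of their tensor
products are complements of `i □ k`. This settles degreewise split monomorphisms, and also
projective cofibrations, as projectives are closed under tensor products. A mixed cofibration is a
retract of a projective cofibration followed by a Hurewicz acyclic cofibration. By the tensor-hom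
adjunction, the `k` for which `i □ k` is a mixed cofibration form a left lifting class, so it
suffices to treat these two kinds of maps, in one variable and then in the other
(`mixedCof_pushoutProduct`).

For the unit axiom, a cofibrant replacement `Q ⟶ 𝟙` is a quasi-isomorphism between mixed cofibrant
objects, hence a homotopy equivalence (`homotopyEquivalences_of_mixedCof`), and stays one after
tensoring.

The model structures themselves need one lifting property and two factorizations each
(`modelCategoryOfFactorizations`). An acyclic Hurewicz fibration has a section whose complementary
idempotent is null homotopic, and null homotopies extend along degreewise split monomorphisms. For
the projective structure, lifts and factorizations are built degree by degree, since the acyclic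
fibrations `p` are the maps which are onto in degree 0 and onto the pairs `(y, x)` with `x` a cycle
and `p x = d y`. -/

namespace EnrichedModel

/-! ### Model structures from one lifting property and two factorizations -/

section Factorizations

variable {C : Type u} [Category.{v} C] (W Cof Fib : MorphismProperty C)

/-- A cofibration that is a weak equivalence lifts against all fibrations, provided every morphism
factors as an acyclic cofibration with this lifting property followed by a fibration. -/
lemma acyclicCof_le_llp [W.HasTwoOutOfThreeProperty] (lift : Cof ≤ (Fib ⊓ W).llp)
    [MorphismProperty.HasFactorization (Cof ⊓ W ⊓ Fib.llp) Fib] : Cof ⊓ W ≤ Fib.llp := by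
  rintro A B i ⟨hi, hiW⟩
  -- Retract argument: the second factor of `i` is acyclic by two out of three, so `i` lifts against
  -- it and is a retract of the first factor.
  have h := MorphismProperty.factorizationData (Cof ⊓ W ⊓ Fib.llp) Fib i
  have hp : W h.p := W.of_precomp h.i h.p h.hi.1.2 (by rwa [h.fac])
  have := lift _ hi h.p ⟨h.hp, hp⟩
  exact MorphismProperty.of_retract (RetractArrow.ofLeftLiftingProperty h.fac) h.hi.2

/-- The same retract argument; here the lift against the second factor exists by assumption. -/
lemma llp_fib_le_acyclicCof [W.IsStableUnderRetracts] [Cof.IsStableUnderRetracts]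
    [MorphismProperty.HasFactorization (Cof ⊓ W ⊓ Fib.llp) Fib] : Fib.llp ≤ Cof ⊓ W := by
  intro A B i hi
  have h := MorphismProperty.factorizationData (Cof ⊓ W ⊓ Fib.llp) Fib i
  have := hi h.p h.hp
  exact MorphismProperty.of_retract (RetractArrow.ofLeftLiftingProperty h.fac) h.hi.1

/-- The model structure with given weak equivalences, cofibrations and fibrations, from one lifting
property and the two factorizations. -/
@[reducible]
def modelCategoryOfFactorizations [HasFiniteLimits C] [HasFiniteColimits C]
    [W.HasTwoOutOfThreeProperty] [W.IsStableUnderRetracts] [Cof.IsStableUnderRetracts]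
    [Fib.IsStableUnderRetracts] (lift : Cof ≤ (Fib ⊓ W).llp)
    (fact : MorphismProperty.HasFactorization Cof (Fib ⊓ W))
    (fact' : MorphismProperty.HasFactorization (Cof ⊓ W ⊓ Fib.llp) Fib) : ModelCategory C where
  categoryWithFibrations := ⟨Fib⟩
  categoryWithCofibrations := ⟨Cof⟩
  categoryWithWeakEquivalences := ⟨W⟩
  cm2 := ‹_›
  cm3a := ‹_›
  cm3b := ‹_›
  cm3c := ‹_›
  cm4a i p hi hiW hp := acyclicCof_le_llp W Cof Fib lift i ⟨hi.mem, hiW.mem⟩ p hp.mem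
  cm4b i p hi hp hpW := lift i hi.mem p ⟨hp.mem, hpW.mem⟩
  cm5a := ⟨fun f => by
    have h := MorphismProperty.factorizationData (Cof ⊓ W ⊓ Fib.llp) Fib f
    exact ⟨⟨h.Z, h.i, h.p, h.fac, h.hi.1, h.hp⟩⟩⟩
  cm5b := fact

end Factorizations

/-! ### Pushout-products and left lifting classes -/

section Leibniz

variable {V : Type u} [Category.{v} V] [MonoidalCategory V] [MonoidalClosed V]
  [HasPullbacks V]

/-- The maps `k` whose pushout-product with `i` has the left lifting property with respect to `P`
form a class of the form `llp`. -/
lemma pushoutProduct_mem_llp_iff {X Y : V} (i : X ⟶ Y) (P : MorphismProperty V) {A B : V}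
    (k : A ⟶ B) (sq : (curriedTensor V).PushoutObjObj i k) :
    P.llp sq.ι ↔ (MorphismProperty.ofHoms
      (fun p : { p : Arrow V // P p.hom } =>
        (Functor.PullbackObjObj.ofHasPullback MonoidalClosed.internalHom i p.1.hom).π)).llp k := by
  -- By the two-variable adjunction, `i □ k` lifts against `p` if and only if `k` lifts against the
  -- pullback-hom of `i` and `p`.
  constructor
  · rintro h _ _ _ ⟨p⟩
    exact (MonoidalClosed.internalHomAdjunction₂.hasLiftingProperty_iff sq _).1 (h _ p.2)
  · intro h E F p hp
    exact (MonoidalClosed.internalHomAdjunction₂.hasLiftingProperty_iff sq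
      (Functor.PullbackObjObj.ofHasPullback _ i p)).2 (h _ (MorphismProperty.ofHoms.mk (⟨Arrow.mk p, hp⟩ : { p : Arrow V // P p.hom })))

end Leibniz

end EnrichedModel

namespace ChNN

variable {R : Type u} [CommRing R]

/-! ### Sums of disc complexes -/

section Disc

variable (G : ℕ → ModuleCat.{u} R)

/-- The module `G (n - 1)`, which is trivial for `n = 0`. -/
def shiftUp : ℕ → ModuleCat.{u} R
  | 0 => ModuleCat.of R PUnit
  | n + 1 => G n

/-- The sum over `n` of the disc complexes with `G n` in degrees `n + 1` and `n`. -/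
noncomputable def disc : ChNN R :=
  ChainComplex.of (fun n => ModuleCat.of R (G n × shiftUp G n))
    (fun n => ModuleCat.ofHom (LinearMap.inl R (G n) (shiftUp G n) ∘ₗ
      LinearMap.snd R (G (n + 1)) (G n)))
    (fun n => by ext : 2 <;> rfl)

variable {G}

/-- The inclusion of `G n` in degree `n` of `disc G`. -/
noncomputable def discBot (n : ℕ) : G n ⟶ (disc G).X n :=
  ModuleCat.ofHom (LinearMap.inl R (G n) (shiftUp G n))

/-- The inclusion of `G n` in degree `n + 1` of `disc G`. -/
noncomputable def discTop (n : ℕ) : G n ⟶ (disc G).X (n + 1) :=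
  ModuleCat.ofHom (LinearMap.inr R (G (n + 1)) (G n))

/-- The projection of `disc G` in degree `n` to `G n`. -/
noncomputable def discFst (n : ℕ) : (disc G).X n ⟶ G n :=
  ModuleCat.ofHom (LinearMap.fst R (G n) (shiftUp G n))

/-- The projection of `disc G` in degree `n + 1` to `G n`. -/
noncomputable def discSnd (n : ℕ) : (disc G).X (n + 1) ⟶ G n :=
  ModuleCat.ofHom (LinearMap.snd R (G (n + 1)) (G n))

@[simp]
lemma discBot_fst (n : ℕ) : discBot (G := G) n ≫ discFst n = 𝟙 _ := rfl

@[simp]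
lemma discTop_fst (n : ℕ) : discTop (G := G) n ≫ discFst (n + 1) = 0 := rfl

@[simp]
lemma discBot_snd (n : ℕ) : discBot (G := G) (n + 1) ≫ discSnd n = 0 := rfl

@[simp]
lemma discBot_fst_assoc (n : ℕ) {A : ModuleCat.{u} R} (f : G n ⟶ A) :
    discBot n ≫ discFst n ≫ f = f := rfl

@[simp]
lemma discTop_snd_assoc (n : ℕ) {A : ModuleCat.{u} R} (f : G n ⟶ A) :
    discTop n ≫ discSnd n ≫ f = f := rfl

@[simp]
lemma discTop_fst_assoc (n : ℕ) {A : ModuleCat.{u} R} (f : G (n + 1) ⟶ A) :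
    discTop n ≫ discFst (n + 1) ≫ f = 0 := by
  rw [← Category.assoc, discTop_fst, zero_comp]

@[simp]
lemma discBot_snd_assoc (n : ℕ) {A : ModuleCat.{u} R} (f : G n ⟶ A) :
    discBot (n + 1) ≫ discSnd n ≫ f = 0 := by
  rw [← Category.assoc, discBot_snd, zero_comp]

lemma disc_total_zero : discFst (G := G) 0 ≫ discBot 0 = 𝟙 _ := rfl

lemma disc_total_succ (n : ℕ) :
    discFst (G := G) (n + 1) ≫ discBot (n + 1) + discSnd n ≫ discTop n = 𝟙 _ := by
  apply ModuleCat.hom_ext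
  apply LinearMap.ext
  rintro ⟨x, y⟩
  exact Prod.ext (add_zero x) (zero_add y)

lemma disc_d (n : ℕ) : (disc G).d (n + 1) n = discSnd n ≫ discBot n :=
  ChainComplex.of_d (fun n => ModuleCat.of R (G n × shiftUp G n))
    (fun n => ModuleCat.ofHom (LinearMap.inl R (G n) (shiftUp G n) ∘ₗ
      LinearMap.snd R (G (n + 1)) (G n))) n

@[simp]
lemma discBot_d (n : ℕ) : discBot (G := G) (n + 1) ≫ (disc G).d (n + 1) n = 0 := by
  rw [disc_d, discBot_snd_assoc]

@[simp]
lemma discBot_d_assoc (n : ℕ) {A : ModuleCat.{u} R} (f : (disc G).X n ⟶ A) :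
    discBot (n + 1) ≫ (disc G).d (n + 1) n ≫ f = 0 := by
  rw [← Category.assoc, discBot_d, zero_comp]

@[simp]
lemma discTop_d (n : ℕ) : discTop (G := G) n ≫ (disc G).d (n + 1) n = discBot n := by
  rw [disc_d, discTop_snd_assoc]

@[simp]
lemma discTop_d_assoc (n : ℕ) {A : ModuleCat.{u} R} (f : (disc G).X n ⟶ A) :
    discTop n ≫ (disc G).d (n + 1) n ≫ f = discBot n ≫ f := by
  rw [← Category.assoc, discTop_d]

lemma disc_hom_ext_zero {A : ModuleCat.{u} R} {f g : (disc G).X 0 ⟶ A}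
    (h : discBot 0 ≫ f = discBot 0 ≫ g) : f = g := by
  rw [← Category.id_comp f, ← Category.id_comp g, ← disc_total_zero, Category.assoc, h,
    Category.assoc]

lemma disc_hom_ext_succ {n : ℕ} {A : ModuleCat.{u} R} {f g : (disc G).X (n + 1) ⟶ A}
    (h : discBot (n + 1) ≫ f = discBot (n + 1) ≫ g) (h' : discTop n ≫ f = discTop n ≫ g) :
    f = g := by
  rw [← Category.id_comp f, ← Category.id_comp g, ← disc_total_succ]
  simp only [Preadditive.add_comp, Category.assoc, h, h']

/-- The bottom cells are the boundaries of the top cells, so a chain map is determined on the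
latter. -/
lemma disc_hom_ext {Y : ChNN R} {φ ψ : disc G ⟶ Y}
    (h : ∀ n, discTop n ≫ φ.f (n + 1) = discTop n ≫ ψ.f (n + 1)) : φ = ψ := by
  have hb (n : ℕ) : discBot n ≫ φ.f n = discBot n ≫ ψ.f n := by
    rw [← discTop_d_assoc, ← discTop_d_assoc, ← φ.comm, ← ψ.comm, reassoc_of% (h n)]
  ext n : 1
  obtain _ | n := n
  · exact disc_hom_ext_zero (hb 0)
  · exact disc_hom_ext_succ (hb (n + 1)) (h n)

/-- Degreewise description of `discDesc`. -/
noncomputable def discDescX {Y : ChNN R} (c : ∀ n, G n ⟶ Y.X (n + 1)) :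
    ∀ n, (disc G).X n ⟶ Y.X n
  | 0 => discFst 0 ≫ c 0 ≫ Y.d 1 0
  | n + 1 => discFst (n + 1) ≫ c (n + 1) ≫ Y.d (n + 1 + 1) (n + 1) + discSnd n ≫ c n

/-- The chain map out of `disc G` with given components on the top cells. -/
noncomputable def discDesc {Y : ChNN R} (c : ∀ n, G n ⟶ Y.X (n + 1)) : disc G ⟶ Y where
  f := discDescX c
  comm' := by
    rintro _ n rfl
    apply disc_hom_ext_succ
    · obtain _ | n := n <;> simp [discDescX]
    · obtain _ | n := n <;> simp [discDescX]

@[simp]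
lemma discTop_desc {Y : ChNN R} (c : ∀ n, G n ⟶ Y.X (n + 1)) (n : ℕ) :
    discTop n ≫ (discDesc c).f (n + 1) = c n := by
  simp [discDesc, discDescX]

@[simp]
lemma discTop_desc_assoc {Y : ChNN R} (c : ∀ n, G n ⟶ Y.X (n + 1)) (n : ℕ) {A : ModuleCat.{u} R}
    (f : Y.X (n + 1) ⟶ A) : discTop n ≫ (discDesc c).f (n + 1) ≫ f = c n ≫ f := by
  rw [← Category.assoc, discTop_desc]

/-- Degreewise description of `discLift`. -/
noncomputable def discLiftX {X : ChNN R} (a : ∀ n, X.X n ⟶ G n) : ∀ n, X.X n ⟶ (disc G).X n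
  | 0 => a 0 ≫ discBot 0
  | n + 1 => a (n + 1) ≫ discBot (n + 1) + X.d (n + 1) n ≫ a n ≫ discTop n

/-- The chain map into `disc G` with given components on the bottom cells. -/
noncomputable def discLift {X : ChNN R} (a : ∀ n, X.X n ⟶ G n) : X ⟶ disc G where
  f := discLiftX a
  comm' := by
    rintro _ n rfl
    obtain _ | n := n <;> simp [discLiftX]

@[simp]
lemma discLift_fst {X : ChNN R} (a : ∀ n, X.X n ⟶ G n) (n : ℕ) :
    (discLift a).f n ≫ discFst n = a n := by
  obtain _ | n := n <;> simp [discLift, discLiftX]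

variable (G) in
-- The contraction moves each bottom cell to its copy one degree higher.
lemma exists_disc_contraction :
    ∃ h : ∀ i j, (ComplexShape.down ℕ).Rel j i → ((disc G).X i ⟶ (disc G).X j),
      Homotopy.nullHomotopicMap' h = 𝟙 (disc G) := by
  refine ⟨fun i j hij => discFst i ≫ discTop i ≫ eqToHom (congrArg (disc G).X hij), ?_⟩
  apply disc_hom_ext
  intro n
  rw [Homotopy.nullHomotopicMap'_f (k₂ := n + 2) (k₁ := n + 1) (k₀ := n) rfl rfl]
  simp

variable (G) in
lemma exists_homotopy_disc : Nonempty (Homotopy (𝟙 (disc G)) 0) := by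
  obtain ⟨h, hh⟩ := exists_disc_contraction G
  exact ⟨hh ▸ Homotopy.nullHomotopy' h⟩

instance projective_disc [∀ n, Projective (G n)] (n : ℕ) : Projective ((disc G).X n) where
  factors {E Y} f e he := by
    obtain _ | n := n
    · exact ⟨discFst 0 ≫ Projective.factorThru (discBot 0 ≫ f) e, disc_hom_ext_zero (by simp)⟩
    · exact ⟨discFst (n + 1) ≫ Projective.factorThru (discBot (n + 1) ≫ f) e +
        discSnd n ≫ Projective.factorThru (discTop n ≫ f) e,
        disc_hom_ext_succ (by simp) (by simp)⟩

lemma discDesc_comp {X Y : ChNN R} (c : ∀ n, G n ⟶ X.X (n + 1)) (p : X ⟶ Y) :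
    discDesc c ≫ p = discDesc fun n => c n ≫ p.f (n + 1) :=
  disc_hom_ext fun n => by simp

end Disc

/-! ### Adding discs to a complex -/

section DiscFactorizations

/-- The inclusion `X ⟶ X ⊕ disc G` has the left lifting property against `p` if the
maps out of each `G n` lift through the positive degree components of `p`. -/
lemma hasLiftingProperty_inl_disc {A X Y : ChNN R} (G : ℕ → ModuleCat.{u} R) (p : X ⟶ Y)
    (hp : ∀ (n : ℕ) (c : G n ⟶ Y.X (n + 1)), ∃ c' : G n ⟶ X.X (n + 1), c' ≫ p.f (n + 1) = c) :
    HasLiftingProperty (biprod.inl : A ⟶ A ⊞ disc G) p where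
  sq_hasLift {a b} sq := by
    -- Maps out of `disc G` are free on the top cells, so it is enough to lift these, and they sit
    -- in positive degrees.
    choose c hc using fun n => hp n (discTop n ≫ (biprod.inr ≫ b).f (n + 1))
    exact ⟨⟨{
      l := biprod.desc a (discDesc c)
      fac_left := by simp
      fac_right := by
        apply biprod.hom_ext'
        · simpa using sq.w
        · rw [biprod.inr_desc_assoc, discDesc_comp]
          exact disc_hom_ext fun n => by simp [hc] }⟩⟩

lemma homotopyEquivalences_inl_disc (A : ChNN R) (G : ℕ → ModuleCat.{u} R) :
    homotopyEquivalences _ _ (biprod.inl : A ⟶ A ⊞ disc G) := by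
  obtain ⟨h⟩ := exists_homotopy_disc G
  refine ⟨⟨biprod.inl, biprod.fst, Homotopy.ofEq (by simp), ?_⟩, rfl⟩
  refine Homotopy.symm (Homotopy.trans (Homotopy.ofEq (g := biprod.fst ≫ biprod.inl +
    biprod.snd ≫ 𝟙 _ ≫ biprod.inr) (by simp [biprod.total])) ?_)
  refine ((Homotopy.refl _).add ((h.compRight biprod.inr).compLeft biprod.snd)).trans ?_
  exact Homotopy.ofEq (by simp)

lemma homotopyEquivalences_fst_disc (A : ChNN R) (G : ℕ → ModuleCat.{u} R) :
    homotopyEquivalences _ _ (biprod.fst : A ⊞ disc G ⟶ A) :=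
  MorphismProperty.of_precomp _ (biprod.inl : A ⟶ A ⊞ disc G) _
    (homotopyEquivalences_inl_disc A G) (by simpa using homotopyEquivalences.of_isIso (𝟙 A))

end DiscFactorizations

end ChNN

/-! ### Closure under retracts of the classes of maps -/

lemma isSplitMono_of_retract {C : Type u} [Category.{v} C] {X Y Z W : C} {f : X ⟶ Y} {g : Z ⟶ W}
    (h : RetractArrow f g) (hg : IsSplitMono g) : IsSplitMono f :=
  ⟨⟨h.i.right ≫ retraction g ≫ h.r.left, by
    have := h.i_w_assoc (retraction g ≫ h.r.left)
    rw [← this, IsSplitMono.id_assoc, h.retract_left]⟩⟩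

lemma isSplitEpi_of_retract {C : Type u} [Category.{v} C] {X Y Z W : C} {f : X ⟶ Y} {g : Z ⟶ W}
    (h : RetractArrow f g) (hg : IsSplitEpi g) : IsSplitEpi f :=
  ⟨⟨h.i.right ≫ section_ g ≫ h.r.left, by
    have := h.r_w
    rw [Category.assoc, Category.assoc, this, IsSplitEpi.id_assoc, h.retract_right]⟩⟩

namespace ChNN

variable (R : Type u) [CommRing R]

/-- Degreewise split monomorphisms. -/
def splitMonoDegreewise : MorphismProperty (ChNN R) :=
  fun _ _ f => ∀ n : ℕ, IsSplitMono (f.f n)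

/-- Chain maps whose components in positive degrees are epimorphisms. -/
def epiPos : MorphismProperty (ChNN R) :=
  fun _ _ f => ∀ n : ℕ, 0 < n → Epi (f.f n)

/-- The degree `n` part of a retract of chain maps. -/
def retractArrowEval {X Y Z W : ChNN R} {f : X ⟶ Y} {g : Z ⟶ W} (h : RetractArrow f g) (n : ℕ) :
    RetractArrow (f.f n) (g.f n) :=
  h.map (HomologicalComplex.eval (ModuleCat.{u} R) (ComplexShape.down ℕ) n)

instance : (splitMonoDegreewise R).IsStableUnderRetracts where
  of_retract h hg n := isSplitMono_of_retract (retractArrowEval R h n) (hg n)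

instance : (splitEpiPos R).IsStableUnderRetracts where
  of_retract h hg n hn := isSplitEpi_of_retract (retractArrowEval R h n) (hg n hn)

instance : (epiPos R).IsStableUnderRetracts where
  of_retract h hg n hn :=
    MorphismProperty.of_retract (P := MorphismProperty.epimorphisms _) (retractArrowEval R h n)
      (hg n hn)

/-- Homotopy equivalences are the maps that become isomorphisms in the homotopy category, and
isomorphisms are stable under retracts. -/
instance :
    (homotopyEquivalences (ModuleCat.{u} R) (ComplexShape.down ℕ)).IsStableUnderRetracts := by
  rw [← HomotopyCategory.inverseImage_quotient_isomorphisms]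
  infer_instance

lemma splitEpiPos_le_epiPos : splitEpiPos R ≤ epiPos R := fun _ _ _ hf n hn =>
  have := hf n hn
  inferInstance

/-! ### The Hurewicz lifting property -/

variable {R}

/-- A fibration of the Hurewicz model structure which is a homotopy equivalence has a section. -/
lemma exists_section {X Y : ChNN R} (p : X ⟶ Y) (hp : splitEpiPos R p) (e : HomotopyEquiv X Y)
    (he : e.hom = p) : ∃ s : Y ⟶ X, s ≫ p = 𝟙 Y ∧ Nonempty (Homotopy (p ≫ s) (𝟙 X)) := by
  subst he
  have hp' (n : ℕ) : ∃ σ : Y.X (n + 1) ⟶ X.X (n + 1), σ ≫ e.hom.f (n + 1) = 𝟙 _ :=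
    have := hp (n + 1) n.succ_pos
    ⟨section_ _, IsSplitEpi.id _⟩
  choose σ hσ using hp'
  -- The homotopy from `e.inv ≫ e.hom` to the identity, lifted through the sections `σ`. Homotopies
  -- raise degree, so sections in positive degrees suffice.
  let k (i j : ℕ) (hij : (ComplexShape.down ℕ).Rel j i) : Y.X i ⟶ X.X j :=
    e.homotopyInvHomId.hom i j ≫ eqToHom (by rw [← show i + 1 = j from hij]) ≫
      σ i ≫ eqToHom (by rw [← show i + 1 = j from hij])
  have hk : (fun i j hij => k i j hij ≫ e.hom.f j) = fun i j _ => e.homotopyInvHomId.hom i j := by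
    funext i j hij
    obtain rfl : i + 1 = j := hij
    simp [k, hσ]
  -- The lifted family measures the failure of `e.inv` to be a strict section; subtracting its
  -- boundary changes `e.inv` only up to homotopy.
  have hs : (e.inv - Homotopy.nullHomotopicMap' k) ≫ e.hom = 𝟙 Y := by
    rw [Preadditive.sub_comp, Homotopy.nullHomotopicMap'_comp, hk, sub_eq_iff_eq_add]
    ext n : 1
    have h := e.homotopyInvHomId.comm n
    rw [h, add_comm]
    congr 1
    obtain _ | n := n
    · rw [Homotopy.nullHomotopicMap'_f_of_not_rel_left (k₁ := 1) (k₀ := 0) rfl (by simp),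
        Homotopy.dNext_zero_chainComplex, Homotopy.prevD_chainComplex]
      simp
    · rw [Homotopy.nullHomotopicMap'_f (k₂ := n + 2) (k₁ := n + 1) (k₀ := n) rfl rfl,
        Homotopy.dNext_succ_chainComplex, Homotopy.prevD_chainComplex]
  refine ⟨_, hs, ⟨Homotopy.trans ?_ e.homotopyHomInvId⟩⟩
  refine Homotopy.compLeft ?_ e.hom
  refine (Homotopy.equivSubZero.symm ((Homotopy.ofEq ?_).trans (Homotopy.nullHomotopy' k))).symm
  simp

lemma homotopy_eq_nullHomotopicMap' {X Y : ChNN R} {f : X ⟶ Y} (h : Homotopy f 0) :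
    f = Homotopy.nullHomotopicMap' fun i j _ => h.hom i j := by
  ext n : 1
  refine (h.comm n).trans ?_
  obtain _ | n := n
  · rw [Homotopy.nullHomotopicMap'_f_of_not_rel_left (k₁ := 1) (k₀ := 0) rfl (by simp),
      Homotopy.dNext_zero_chainComplex, Homotopy.prevD_chainComplex]
    simp
  · rw [Homotopy.nullHomotopicMap'_f (k₂ := n + 2) (k₁ := n + 1) (k₀ := n) rfl rfl,
      Homotopy.dNext_succ_chainComplex, Homotopy.prevD_chainComplex]
    simp

/-- If `e` is a null homotopic map, then `a ≫ e` extends along degreewise split monomorphisms, to a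
map which is annihilated by all maps which annihilate `e`. -/
lemma exists_extension_of_nullHomotopic {A B X X' Y : ChNN R} (i : A ⟶ B)
    (hi : splitMonoDegreewise R i) (a : A ⟶ X) (e : X ⟶ X') (h : Homotopy e 0) (e' : X' ⟶ Y) :
    ∃ F : B ⟶ Y, i ≫ F = a ≫ e ≫ e' ∧ ∀ {Z : ChNN R} (p : Y ⟶ Z), e' ≫ p = 0 → F ≫ p = 0 := by
  have hi' (n : ℕ) : ∃ r : B.X n ⟶ A.X n, i.f n ≫ r = 𝟙 _ :=
    have := hi n
    ⟨retraction _, IsSplitMono.id _⟩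
  choose r hr using hi'
  -- The retractions `r` do not commute with differentials, but any graded family of maps of degree
  -- 1 has a chain map as its boundary, so the null homotopy can be extended instead of the map.
  refine ⟨Homotopy.nullHomotopicMap' (fun m n _ => r m ≫ a.f m ≫ h.hom m n) ≫ e',
    ?_, fun p hp => by rw [Category.assoc, hp, comp_zero]⟩
  rw [← Category.assoc, ← Category.assoc, Homotopy.comp_nullHomotopicMap']
  refine congrArg (· ≫ e') (Eq.trans ?_ (congrArg (a ≫ ·) (homotopy_eq_nullHomotopicMap' h)).symm)
  rw [Homotopy.comp_nullHomotopicMap']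
  congr 1
  funext m n _
  rw [reassoc_of% hr m]

/-- With a section `s` of `p`, the idempotent `𝟙 X - p ≫ s` is null homotopic and killed by `p`. The
lift is `b ≫ s` corrected by an extension to `B` of `a` followed by this idempotent; the correction
vanishes after `p`. -/
lemma splitMonoDegreewise_le_llp : splitMonoDegreewise R ≤
    (splitEpiPos R ⊓ homotopyEquivalences (ModuleCat.{u} R) (ComplexShape.down ℕ)).llp := by
  rintro A B i hi X Y p ⟨hp, ⟨e, he⟩⟩
  obtain ⟨s, hs, ⟨h⟩⟩ := exists_section p hp e he
  have h' : Homotopy (𝟙 X - p ≫ s) 0 := Homotopy.equivSubZero h.symm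
  have hps : (𝟙 X - p ≫ s) ≫ p = 0 := by simp [hs]
  refine ⟨fun {a b} sq => ?_⟩
  obtain ⟨F, hF, hF'⟩ := exists_extension_of_nullHomotopic i hi a _ h' (𝟙 X - p ≫ s)
  have hsub : (𝟙 X - p ≫ s) ≫ (𝟙 X - p ≫ s) = 𝟙 X - p ≫ s := by
    rw [Preadditive.comp_sub, reassoc_of% hps]
    simp
  exact ⟨⟨{
    l := b ≫ s + F
    fac_left := by
      rw [Preadditive.comp_add, hF, hsub, ← sq.w_assoc]
      simp
    fac_right := by
      rw [Preadditive.add_comp, hF' p hps, Category.assoc, hs]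
      simp }⟩⟩

end ChNN

/-! ### Monomorphisms with projective cokernel -/

open EnrichedModel

/-- A split monomorphism with projective complement lifts against epimorphisms. -/
lemma epimorphisms_llp_of_decomposition {C : Type u} [Category.{v} C] [Preadditive C] {A B P : C}
    [Projective P] (i : A ⟶ B) (r : B ⟶ A) (s : B ⟶ P) (t : P ⟶ B) (hir : i ≫ r = 𝟙 A)
    (his : i ≫ s = 0) (h : r ≫ i + s ≫ t = 𝟙 B) : (MorphismProperty.epimorphisms C).llp i := by
  intro X Y p (hp : Epi p)
  refine ⟨fun {a b} sq => ⟨⟨{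
    l := r ≫ a + s ≫ Projective.factorThru (t ≫ b) p
    fac_left := ?_
    fac_right := ?_ }⟩⟩⟩
  · rw [Preadditive.comp_add, reassoc_of% hir, reassoc_of% his, zero_comp, add_zero]
  · rw [Preadditive.add_comp, Category.assoc, Category.assoc, Projective.factorThru_comp, sq.w,
      ← Category.assoc, ← Category.assoc, ← Preadditive.add_comp, h, Category.id_comp]

/-- A monomorphism with projective cokernel has a complement which is a projective direct summand. -/
lemma exists_projective_complement {C : Type u} [Category.{v} C] [Abelian C] {A B : C} (i : A ⟶ B)
    (hi : Mono i ∧ Projective (cokernel i)) :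
    ∃ (P : C) (r : B ⟶ A) (s : B ⟶ P) (t : P ⟶ B), Projective P ∧ i ≫ r = 𝟙 A ∧ i ≫ s = 0 ∧
      r ≫ i + s ≫ t = 𝟙 B := by
  let S := ShortComplex.mk i (cokernel.π i) (cokernel.condition i)
  have hS : S.ShortExact :=
    { exact := S.exact_of_g_is_cokernel (cokernelIsCokernel i)
      mono_f := hi.1
      epi_g := show Epi (cokernel.π i) from inferInstance }
  have : Projective S.X₃ := hi.2
  let σ := hS.splittingOfProjective
  exact ⟨S.X₃, σ.r, S.g, σ.s, hi.2, σ.f_r, S.zero, σ.id⟩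

open scoped ZeroObject in
-- Turns the description of projective cofibrations into a degreewise lifting property. Lifting
-- against `A ⟶ 0` gives a retraction; lifting a map that vanishes on `A` gives projectivity of the
-- cokernel.
lemma epimorphisms_llp_iff {C : Type u} [Category.{v} C] [Abelian C] {A B : C} (i : A ⟶ B) :
    (MorphismProperty.epimorphisms C).llp i ↔ Mono i ∧ Projective (cokernel i) := by
  constructor
  · intro h
    constructor
    · have := h (0 : A ⟶ (0 : C)) (show Epi _ from inferInstance)
      have sq : CommSq (𝟙 A) i (0 : A ⟶ (0 : C)) 0 := ⟨by simp⟩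
      have : Mono (i ≫ sq.lift) := by rw [sq.fac_left]; infer_instance
      exact mono_of_mono i sq.lift
    · refine ⟨fun {E X} f e he => ?_⟩
      have := h e he
      have sq : CommSq (0 : A ⟶ E) i e (cokernel.π i ≫ f) := ⟨by simp⟩
      refine ⟨cokernel.desc i sq.lift sq.fac_left, ?_⟩
      rw [← cancel_epi (cokernel.π i)]
      simp
  · intro hi
    obtain ⟨P, r, s, t, _, hr, hs, h⟩ := exists_projective_complement i hi
    exact epimorphisms_llp_of_decomposition i r s t hr hs h

namespace ChNN

variable (R : Type u) [CommRing R]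

/-- Degreewise monomorphisms with projective cokernel. -/
def projCof : MorphismProperty (ChNN R) :=
  fun _ _ f => ∀ n : ℕ, Mono (f.f n) ∧ Projective (cokernel (f.f n))

variable {R}

lemma projCof_iff {X Y : ChNN R} (f : X ⟶ Y) :
    projCof R f ↔ ∀ n, (MorphismProperty.epimorphisms (ModuleCat.{u} R)).llp (f.f n) :=
  forall_congr' fun _ => (epimorphisms_llp_iff _).symm

instance : (projCof R).IsStableUnderRetracts where
  of_retract h hg := (projCof_iff _).2 fun n =>
    MorphismProperty.of_retract (retractArrowEval R h n) ((projCof_iff _).1 hg n)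

/-! ### Factorizations through sums with discs -/

lemma isSplitMono_inl_f (A B : ChNN R) (n : ℕ) :
    IsSplitMono ((biprod.inl : A ⟶ A ⊞ B).f n) :=
  ⟨⟨(biprod.fst : A ⊞ B ⟶ A).f n, by simp⟩⟩

lemma discTop_inr_desc {X Y : ChNN R} {G : ℕ → ModuleCat.{u} R} (f : X ⟶ Y)
    (c : ∀ n, G n ⟶ Y.X (n + 1)) (n : ℕ) :
    (discTop n ≫ (biprod.inr : disc G ⟶ X ⊞ disc G).f (n + 1)) ≫
      (biprod.desc f (discDesc c)).f (n + 1) = c n := by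
  simp

/-- A disc is added for each positive degree of `Y`; its top cell maps identically to `Y` and so
provides the splitting. -/
instance hurewicz_factorization_acyclicCof : MorphismProperty.HasFactorization
    (splitMonoDegreewise R ⊓ homotopyEquivalences _ _ ⊓ (splitEpiPos R).llp) (splitEpiPos R) where
  nonempty_mapFactorizationData {X Y} f := ⟨{
    Z := X ⊞ disc fun n => Y.X (n + 1)
    i := biprod.inl
    p := biprod.desc f (discDesc fun n => 𝟙 _)
    fac := by simp
    hi := ⟨⟨isSplitMono_inl_f _ _, homotopyEquivalences_inl_disc _ _⟩, fun _ _ p hp =>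
      hasLiftingProperty_inl_disc _ p fun n c =>
        have := hp (n + 1) n.succ_pos
        ⟨c ≫ section_ (p.f (n + 1)), by simp⟩⟩
    hp := fun n hn => by
      obtain ⟨n, rfl⟩ := Nat.exists_eq_succ_of_ne_zero hn.ne'
      exact ⟨⟨_, discTop_inr_desc f (fun n => 𝟙 (Y.X (n + 1))) n⟩⟩ }⟩

/-- A mapping cylinder argument: `X` embeds, degreewise split, into the contractible complex `disc
X.X`. -/
instance hurewicz_factorization_acyclicFib : MorphismProperty.HasFactorization
    (splitMonoDegreewise R) (splitEpiPos R ⊓ homotopyEquivalences _ _) where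
  nonempty_mapFactorizationData {X Y} f := ⟨{
    Z := Y ⊞ disc X.X
    i := biprod.lift f (discLift fun n => 𝟙 _)
    p := biprod.fst
    fac := by simp
    hi := fun n => ⟨⟨(biprod.snd : Y ⊞ disc X.X ⟶ _).f n ≫ discFst n, by simp⟩⟩
    hp := ⟨fun n _ => ⟨⟨(biprod.inl : Y ⟶ _).f n, by simp⟩⟩, homotopyEquivalences_fst_disc _ _⟩ }⟩

variable (R) in
/-- The Hurewicz model structure. -/
@[reducible]
def hurewicz : ModelCategory (ChNN R) :=
  modelCategoryOfFactorizations (homotopyEquivalences _ _) (splitMonoDegreewise R) (splitEpiPos R)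
    splitMonoDegreewise_le_llp inferInstance inferInstance

lemma isHurewiczModel_hurewicz : IsHurewiczModel R (hurewicz R) := ⟨rfl, rfl, rfl⟩

/-- The free module on the underlying set of a module. -/
noncomputable def freeCover (M : ModuleCat.{u} R) : ModuleCat.{u} R := ModuleCat.of R (M →₀ R)

/-- The map out of a free module with given values on the basis. -/
noncomputable def freeCoverDesc {M N : ModuleCat.{u} R} (f : M → N) : freeCover M ⟶ N :=
  ModuleCat.ofHom (Finsupp.linearCombination R f)

/-- The basis element of the free module corresponding to `x`. -/
noncomputable def freeCoverMk {M : ModuleCat.{u} R} (x : M) : freeCover M :=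
  Finsupp.single x (1 : R)

@[simp]
lemma freeCoverDesc_mk {M N : ModuleCat.{u} R} (f : M → N) (x : M) :
    freeCoverDesc f (freeCoverMk x) = f x :=
  (Finsupp.linearCombination_single R 1 x).trans (one_smul R (f x))

lemma freeCover_hom_ext {M N : ModuleCat.{u} R} {f g : freeCover M ⟶ N}
    (h : ∀ x, f (freeCoverMk x) = g (freeCoverMk x)) : f = g :=
  ModuleCat.hom_ext (Finsupp.lhom_ext' fun x => LinearMap.ext_ring (h x))

/-- The canonical epimorphism from the free module on the underlying set. -/
noncomputable def freeCoverπ (M : ModuleCat.{u} R) : freeCover M ⟶ M := freeCoverDesc id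

instance (M : ModuleCat.{u} R) : Projective (freeCover M) :=
  ModuleCat.projective_of_free (Finsupp.basisSingleOne (R := R))

instance (M : ModuleCat.{u} R) : Epi (freeCoverπ M) :=
  (ModuleCat.epi_iff_surjective _).2 fun x => ⟨freeCoverMk x, freeCoverDesc_mk _ _⟩

lemma projCof_inl_disc (A : ChNN R) (G : ℕ → ModuleCat.{u} R) [∀ n, Projective (G n)] :
    projCof R (biprod.inl : A ⟶ A ⊞ disc G) :=
  (projCof_iff _).2 fun n => epimorphisms_llp_of_decomposition _
    ((biprod.fst : A ⊞ disc G ⟶ A).f n) ((biprod.snd : A ⊞ disc G ⟶ _).f n)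
    ((biprod.inr : disc G ⟶ A ⊞ disc G).f n) (by simp) (by simp) (by simp)

/-- As in the Hurewicz case, with free covers so that the added discs are degreewise projective. -/
instance projective_factorization_acyclicCof : MorphismProperty.HasFactorization
    (projCof R ⊓ quasiIso _ _ ⊓ (epiPos R).llp) (epiPos R) where
  nonempty_mapFactorizationData {X Y} f := ⟨{
    Z := X ⊞ disc fun n => freeCover (Y.X (n + 1))
    i := biprod.inl
    p := biprod.desc f (discDesc fun n => freeCoverπ _)
    fac := by simp
    hi := ⟨⟨projCof_inl_disc _ _,
      homotopyEquivalences_le_quasiIso _ _ _ (homotopyEquivalences_inl_disc _ _)⟩,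
        fun _ _ p hp => hasLiftingProperty_inl_disc _ p fun n c =>
          have := hp (n + 1) n.succ_pos
          ⟨Projective.factorThru c _, Projective.factorThru_comp _ _⟩⟩
    hp := fun n hn => by
      obtain ⟨n, rfl⟩ := Nat.exists_eq_succ_of_ne_zero hn.ne'
      exact epi_of_epi_fac (discTop_inr_desc f (fun n => freeCoverπ (Y.X (n + 1))) n) }⟩

end ChNN

namespace ChNN

open EnrichedModel

variable {R : Type u} [CommRing R]

/-! ### Acyclic projective fibrations in terms of cycles -/

section AcyclicFibrations

variable {X Y : ChNN R} (p : X ⟶ Y)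

/-- The pairs `(y, x)` with `x` a cycle of degree `n` and `p x = d y`. -/
noncomputable def cycleFiber (n : ℕ) : Submodule R (Y.X (n + 1) × X.X n) :=
  LinearMap.ker (((X.d n (n - 1)).hom ∘ₗ LinearMap.snd R (Y.X (n + 1)) (X.X n)).prod
    ((p.f n).hom ∘ₗ LinearMap.snd R (Y.X (n + 1)) (X.X n) -
      (Y.d (n + 1) n).hom ∘ₗ LinearMap.fst R (Y.X (n + 1)) (X.X n)))

lemma mem_cycleFiber {n : ℕ} (y : Y.X (n + 1)) (x : X.X n) :
    (y, x) ∈ cycleFiber p n ↔ X.d n (n - 1) x = 0 ∧ p.f n x = Y.d (n + 1) n y := by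
  rw [cycleFiber, LinearMap.mem_ker]
  refine Prod.mk_eq_zero.trans (and_congr Iff.rfl ?_)
  exact sub_eq_zero

lemma d_d_pred (X : ChNN R) (n : ℕ) : X.d (n + 1) n ≫ X.d n (n - 1) = 0 := by
  simp

/-- The map into `cycleFiber p n` with given components. -/
noncomputable def cycleFiberLift {n : ℕ} {A : ModuleCat.{u} R} (y : A ⟶ Y.X (n + 1)) (x : A ⟶ X.X n)
    (hx : x ≫ X.d n (n - 1) = 0) (h : x ≫ p.f n = y ≫ Y.d (n + 1) n) :
    A ⟶ ModuleCat.of R (cycleFiber p n) :=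
  ModuleCat.ofHom ((y.hom.prod x.hom).codRestrict _ fun a =>
    (mem_cycleFiber p _ _).2 ⟨ConcreteCategory.congr_hom hx a, ConcreteCategory.congr_hom h a⟩)

/-- The first component of `cycleFiber p n`. -/
noncomputable def cycleFiberFst (n : ℕ) : ModuleCat.of R (cycleFiber p n) ⟶ Y.X (n + 1) :=
  ModuleCat.ofHom (LinearMap.fst R _ _ ∘ₗ (cycleFiber p n).subtype)

/-- The second component of `cycleFiber p n`. -/
noncomputable def cycleFiberSnd (n : ℕ) : ModuleCat.of R (cycleFiber p n) ⟶ X.X n :=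
  ModuleCat.ofHom (LinearMap.snd R _ _ ∘ₗ (cycleFiber p n).subtype)

/-- The canonical map from `X` in degree `n + 1` to the cycle fiber. -/
noncomputable def toCycleFiber (n : ℕ) : X.X (n + 1) ⟶ ModuleCat.of R (cycleFiber p n) :=
  cycleFiberLift p (p.f (n + 1)) (X.d (n + 1) n) (d_d_pred X n) (p.comm _ _).symm

@[simp]
lemma cycleFiberLift_fst {n : ℕ} {A : ModuleCat.{u} R} (y : A ⟶ Y.X (n + 1)) (x : A ⟶ X.X n)
    (hx : x ≫ X.d n (n - 1) = 0) (h : x ≫ p.f n = y ≫ Y.d (n + 1) n) :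
    cycleFiberLift p y x hx h ≫ cycleFiberFst p n = y := rfl

@[simp]
lemma cycleFiberLift_snd {n : ℕ} {A : ModuleCat.{u} R} (y : A ⟶ Y.X (n + 1)) (x : A ⟶ X.X n)
    (hx : x ≫ X.d n (n - 1) = 0) (h : x ≫ p.f n = y ≫ Y.d (n + 1) n) :
    cycleFiberLift p y x hx h ≫ cycleFiberSnd p n = x := rfl

@[simp]
lemma toCycleFiber_fst (n : ℕ) : toCycleFiber p n ≫ cycleFiberFst p n = p.f (n + 1) := rfl

@[simp]
lemma toCycleFiber_snd (n : ℕ) : toCycleFiber p n ≫ cycleFiberSnd p n = X.d (n + 1) n := rfl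

lemma cycleFiber_hom_ext {n : ℕ} {A : ModuleCat.{u} R} {f g : A ⟶ ModuleCat.of R (cycleFiber p n)}
    (h₁ : f ≫ cycleFiberFst p n = g ≫ cycleFiberFst p n)
    (h₂ : f ≫ cycleFiberSnd p n = g ≫ cycleFiberSnd p n) : f = g := by
  apply ModuleCat.hom_ext
  ext a : 1
  exact Subtype.ext (Prod.ext (ConcreteCategory.congr_hom h₁ a) (ConcreteCategory.congr_hom h₂ a))

/-- Justifies truncated subtraction: the successor of 0 is 0 itself, and the differential `d 0 0`
vanishes, so every element of degree 0 is a cycle. -/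
lemma next_down (n : ℕ) : (ComplexShape.down ℕ).next n = n - 1 := by
  obtain _ | n := n <;> simp

lemma exists_boundary_of_quasiIso [QuasiIso p] {n : ℕ} (x : X.X n) (hx : X.d n (n - 1) x = 0)
    (y : Y.X (n + 1)) (hxy : p.f n x = Y.d (n + 1) n y) : ∃ x', X.d (n + 1) n x' = x := by
  have h : Mono (homologyMap p n) := inferInstance
  rw [mono_homologyMap_iff_up_to_refinements p (n + 1) n (n - 1) (by simp) (next_down n)] at h
  -- The criterion is tested on `R ⟶ X.X n`, `1 ↦ x`; evaluating at a preimage of `1` under `π`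
  -- gives back an elementwise statement.
  obtain ⟨A, π, hπ, x₁, hx₁⟩ := h (ModuleCat.ofHom (LinearMap.toSpanSingleton R _ x))
    (by ext; simpa using hx) (ModuleCat.ofHom (LinearMap.toSpanSingleton R _ y))
    (by ext; simpa using hxy)
  obtain ⟨a, ha⟩ := (ModuleCat.epi_iff_surjective π).1 hπ (1 : R)
  refine ⟨x₁ a, (ConcreteCategory.congr_hom hx₁ a).symm.trans ?_⟩
  change (π a : R) • x = x
  rw [ha]
  exact one_smul R x

lemma exists_cycle_of_quasiIso [QuasiIso p] {n : ℕ} (y : Y.X n) (hy : Y.d n (n - 1) y = 0) :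
    ∃ (x : X.X n) (y' : Y.X (n + 1)), X.d n (n - 1) x = 0 ∧ y = p.f n x + Y.d (n + 1) n y' := by
  have h : Epi (homologyMap p n) := inferInstance
  rw [epi_homologyMap_iff_up_to_refinements p (n + 1) n (n - 1) (by simp) (next_down n)] at h
  obtain ⟨A, π, hπ, x, hx, y', h⟩ := h (ModuleCat.ofHom (LinearMap.toSpanSingleton R _ y))
    (by ext; simpa using hy)
  obtain ⟨a, ha⟩ := (ModuleCat.epi_iff_surjective π).1 hπ (1 : R)
  refine ⟨x a, y' a, ConcreteCategory.congr_hom hx a,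
    Eq.trans ?_ (ConcreteCategory.congr_hom h a)⟩
  change y = (π a : R) • y
  rw [ha]
  exact (one_smul R y).symm

/-- Given `(y, x)`, injectivity on homology gives `x = d x'`. Then `p x' - y` is a cycle, so
surjectivity on homology writes it as `p z + d y'` with `z` a cycle; with `y' = p w`, the element
`x' - z - d w` is a preimage. -/
lemma epi_toCycleFiber [QuasiIso p] (hp : epiPos R p) (n : ℕ) : Epi (toCycleFiber p n) := by
  rw [ModuleCat.epi_iff_surjective]
  rintro ⟨⟨y, x⟩, hxy⟩
  rw [mem_cycleFiber] at hxy
  obtain ⟨x', rfl⟩ := exists_boundary_of_quasiIso p x hxy.1 y hxy.2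
  have hd : Y.d (n + 1) n (p.f (n + 1) x' - y) = 0 := by
    rw [map_sub, ← hxy.2, sub_eq_zero]
    exact (ConcreteCategory.congr_hom (p.comm (n + 1) n) x')
  obtain ⟨z, y', hz, h⟩ := exists_cycle_of_quasiIso p _ hd
  obtain ⟨w, rfl⟩ := (ModuleCat.epi_iff_surjective _).1 (hp (n + 2) (by omega)) y'
  have hw : p.f (n + 1) (X.d (n + 2) (n + 1) w) = Y.d (n + 2) (n + 1) (p.f (n + 2) w) :=
    (ConcreteCategory.congr_hom (p.comm (n + 2) (n + 1)) w).symm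
  have hw' : X.d (n + 1) n (X.d (n + 2) (n + 1) w) = 0 :=
    ConcreteCategory.congr_hom (X.d_comp_d (n + 2) (n + 1) n) w
  refine ⟨x' - z - X.d (n + 2) (n + 1) w, Subtype.ext (Prod.ext ?_ ?_)⟩
  · change p.f (n + 1) (x' - z - X.d (n + 2) (n + 1) w) = y
    rw [map_sub, map_sub, hw, sub_sub, ← h]
    abel
  · change X.d (n + 1) n (x' - z - X.d (n + 2) (n + 1) w) = X.d (n + 1) n x'
    rw [map_sub, map_sub, hw', sub_zero]
    exact (congrArg _ hz).trans (sub_zero _)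

lemma epi_f_zero [QuasiIso p] (hp : epiPos R p) : Epi (p.f 0) := by
  rw [ModuleCat.epi_iff_surjective]
  intro y
  obtain ⟨x, y', -, h⟩ := exists_cycle_of_quasiIso p y (by rw [Y.shape _ _ (by simp)]; rfl)
  obtain ⟨w, rfl⟩ := (ModuleCat.epi_iff_surjective _).1 (hp 1 (by omega)) y'
  refine ⟨x + X.d 1 0 w, ?_⟩
  rw [map_add, h]
  congr 1
  exact (ConcreteCategory.congr_hom (p.comm 1 0) w).symm

variable {p}

/-- In positive degrees, lift the pair `(y, 0)`. -/
lemma exists_cycle_lift (h₀ : Epi (p.f 0)) (h : ∀ n, Epi (toCycleFiber p n)) (n : ℕ) (y : Y.X n)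
    (hy : Y.d n (n - 1) y = 0) : ∃ x : X.X n, p.f n x = y ∧ X.d n (n - 1) x = 0 := by
  obtain _ | n := n
  · obtain ⟨x, hx⟩ := (ModuleCat.epi_iff_surjective _).1 h₀ y
    exact ⟨x, hx, by rw [X.shape _ _ (by simp)]; rfl⟩
  · obtain ⟨x, hx⟩ := (ModuleCat.epi_iff_surjective _).1 (h n) ⟨(y, 0),
      (mem_cycleFiber _ _ _).2 ⟨map_zero _, (map_zero _).trans hy.symm⟩⟩
    exact ⟨x, congrArg (fun z => z.1.1) hx, congrArg (fun z => z.1.2) hx⟩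

lemma epiPos_of_toCycleFiber (h₀ : Epi (p.f 0)) (h : ∀ n, Epi (toCycleFiber p n)) :
    epiPos R p := by
  intro n hn
  obtain ⟨n, rfl⟩ := Nat.exists_eq_succ_of_ne_zero hn.ne'
  rw [ModuleCat.epi_iff_surjective]
  intro y
  obtain ⟨x, hx, hx'⟩ := exists_cycle_lift h₀ h n (Y.d (n + 1) n y)
    (ConcreteCategory.congr_hom (d_d_pred Y n) y)
  obtain ⟨x', hx'⟩ := (ModuleCat.epi_iff_surjective _).1 (h n) ⟨(y, x),
      (mem_cycleFiber _ _ _).2 ⟨hx', hx⟩⟩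
  exact ⟨x', congrArg (fun z => z.1.1) hx'⟩

lemma quasiIso_of_toCycleFiber (h₀ : Epi (p.f 0)) (h : ∀ n, Epi (toCycleFiber p n)) :
    QuasiIso p where
  quasiIsoAt n := by
    rw [quasiIsoAt_iff_isIso_homologyMap]
    have : Mono (homologyMap p n) := by
      rw [mono_homologyMap_iff_up_to_refinements p (n + 1) n (n - 1) (by simp) (next_down n)]
      intro A x hx y hxy
      have := h n
      refine ⟨pullback (cycleFiberLift p y x hx hxy) (toCycleFiber p n), pullback.fst _ _,
        inferInstance, pullback.snd _ _, ?_⟩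
      have := pullback.condition (f := cycleFiberLift p y x hx hxy) (g := toCycleFiber p n) =≫
        cycleFiberSnd p n
      rwa [Category.assoc, Category.assoc] at this
    have : Epi (homologyMap p n) := by
      rw [epi_homologyMap_iff_up_to_refinements p (n + 1) n (n - 1) (by simp) (next_down n)]
      intro A y hy
      -- The chosen lifts are not linear in `a`; they define a linear map only on the free module on
      -- the set `A`, which serves as the refinement.
      choose x hx hx' using fun a : A => exists_cycle_lift h₀ h n (y a)
        (ConcreteCategory.congr_hom hy a)
      refine ⟨freeCover A, freeCoverπ A, inferInstance,
        freeCoverDesc x, ?_, 0, ?_⟩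
      · refine freeCover_hom_ext fun a => ?_
        exact (congrArg (X.d n (n - 1)) (freeCoverDesc_mk x a)).trans (hx' a)
      · rw [zero_comp, add_zero]
        refine freeCover_hom_ext fun a => ?_
        exact (congrArg y (freeCoverDesc_mk _ a)).trans
          ((congrArg (p.f n) (freeCoverDesc_mk x a)).trans (hx a)).symm
    exact isIso_of_mono_of_epi _

end AcyclicFibrations

/-! ### Degreewise construction of lifts -/

section Lifting

variable {A B X Y : ChNN R} {i : A ⟶ B} {p : X ⟶ Y} {a : A ⟶ X} {b : B ⟶ Y}

/-- A lift in degree `n` which can be extended to higher degrees. -/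
abbrev PartialLift (i : A ⟶ B) (p : X ⟶ Y) (a : A ⟶ X) (b : B ⟶ Y) (n : ℕ) :=
  { g : B.X n ⟶ X.X n // i.f n ≫ g = a.f n ∧ g ≫ p.f n = b.f n ∧
    B.d (n + 1) n ≫ g ≫ X.d n (n - 1) = 0 }

lemma exists_partialLift_zero (hi : projCof R i) (h₀ : Epi (p.f 0)) (w : a ≫ p = i ≫ b) :
    Nonempty (PartialLift i p a b 0) := by
  have := (projCof_iff i).1 hi 0 (p.f 0) h₀
  have sq : CommSq (a.f 0) (i.f 0) (p.f 0) (b.f 0) := ⟨by rw [← comp_f, w, comp_f]⟩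
  exact ⟨sq.lift, sq.fac_left, sq.fac_right, by rw [X.shape _ _ (by simp)]; simp⟩

/-- A single lift of `i` against `toCycleFiber p n` yields compatibility with `p` and with the
differential at once. The last condition on the previous lift says that the boundary lands in
cycles, so that this lifting problem can be posed. -/
lemma exists_partialLift_succ (hi : projCof R i) (h : ∀ n, Epi (toCycleFiber p n))
    (w : a ≫ p = i ≫ b) (n : ℕ) (g : PartialLift i p a b n) :
    ∃ g' : PartialLift i p a b (n + 1), g'.1 ≫ X.d (n + 1) n = B.d (n + 1) n ≫ g.1 := by
  obtain ⟨g, hg, hg', hd⟩ := g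
  have := (projCof_iff i).1 hi (n + 1) _ (h n)
  have sq : CommSq (a.f (n + 1)) (i.f (n + 1)) (toCycleFiber p n)
      (cycleFiberLift p (b.f (n + 1)) (B.d (n + 1) n ≫ g) (by simpa using hd) (by simp [hg'])) := by
    constructor
    apply cycleFiber_hom_ext
    · simp [← comp_f, w]
    · simp [hg]
  have h₁ := sq.fac_right =≫ cycleFiberFst p n
  have h₂ := sq.fac_right =≫ cycleFiberSnd p n
  simp only [Category.assoc, toCycleFiber_fst, toCycleFiber_snd, cycleFiberLift_fst,
    cycleFiberLift_snd] at h₁ h₂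
  exact ⟨⟨sq.lift, sq.fac_left, h₁, by simp [h₂]⟩, h₂⟩

lemma projCof_le_llp : projCof R ≤
    (epiPos R ⊓ quasiIso (ModuleCat.{u} R) (ComplexShape.down ℕ)).llp := by
  rintro A B i hi X Y p ⟨hp, (hpq : QuasiIso p)⟩
  refine ⟨fun {a b} sq => ?_⟩
  have h₀ := (exists_partialLift_zero hi (epi_f_zero p hp) sq.w).some
  choose next hnext using exists_partialLift_succ hi (epi_toCycleFiber p hp) sq.w
  let g (n : ℕ) : PartialLift i p a b n := Nat.rec h₀ next n
  exact ⟨⟨{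
    l :=
      { f n := (g n).1
        comm' := by
          rintro _ n rfl
          exact hnext n (g n) }
    fac_left := by
      ext n : 1
      exact (g n).2.1
    fac_right := by
      ext n : 1
      exact (g n).2.2.1 }⟩⟩

end Lifting

end ChNN

namespace ChNN

open EnrichedModel

variable {R : Type u} [CommRing R]

/-! ### Degreewise factorization by attaching free modules -/

section Stages

variable {X Y : ChNN R} (f : X ⟶ Y)

/-- The degree `n` part `X_n ⟶ Z ⟶ Y_n` of a factorization of `f`, and the submodule of cycles
of `Z`. -/
structure FactorizationStage (n : ℕ) where
  /-- the intermediate module -/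
  Z : ModuleCat.{u} R
  /-- the cycles of the intermediate module -/
  K : Submodule R Z
  /-- the first map -/
  i : X.X n ⟶ Z
  /-- the second map -/
  p : Z ⟶ Y.X n
  fac : i ≫ p = f.f n
  i_d_mem (x : X.X (n + 1)) : i (X.d (n + 1) n x) ∈ K

namespace FactorizationStage

/-- The initial stage: `X_0 ⊕ F` for a free module `F` covering `Y_0`. -/
noncomputable def zero : FactorizationStage f 0 where
  Z := X.X 0 ⊞ freeCover (Y.X 0)
  -- A stage does not record the differential leaving it, so its cycles are part of the data; in
  -- degree 0 everything is a cycle.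
  K := ⊤
  i := biprod.inl
  p := biprod.desc (f.f 0) (freeCoverπ _)
  fac := by simp
  i_d_mem _ := Submodule.mem_top

variable {f} {n : ℕ} (s : FactorizationStage f n)

/-- The pairs `(y, k)` with `k` a cycle of `s.Z` which maps to `d y`. -/
noncomputable def boundaryPairs : ModuleCat.{u} R :=
  ModuleCat.of R (LinearMap.ker ((s.p.hom ∘ₗ s.K.subtype) ∘ₗ LinearMap.snd R (Y.X (n + 1)) s.K -
    (Y.d (n + 1) n).hom ∘ₗ LinearMap.fst R (Y.X (n + 1)) s.K))

/-- The pair `(y, k)`. -/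
noncomputable def boundaryPairsMk (y : Y.X (n + 1)) (k : s.Z) (hk : k ∈ s.K)
    (h : s.p k = Y.d (n + 1) n y) : s.boundaryPairs :=
  ⟨(y, ⟨k, hk⟩), sub_eq_zero.2 h⟩

/-- The first component of a pair. -/
noncomputable def boundaryFst : s.boundaryPairs ⟶ Y.X (n + 1) :=
  ModuleCat.ofHom (LinearMap.fst R _ _ ∘ₗ Submodule.subtype _)

/-- The second component of a pair, as a cycle. -/
noncomputable def boundaryCycle : s.boundaryPairs ⟶ ModuleCat.of R s.K :=
  ModuleCat.ofHom (LinearMap.snd R _ _ ∘ₗ Submodule.subtype _)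

/-- The differential of `X`, followed by the first map, with values in the cycles. -/
noncomputable def iCycle : X.X (n + 1) ⟶ ModuleCat.of R s.K :=
  ModuleCat.ofHom ((X.d (n + 1) n ≫ s.i).hom.codRestrict s.K s.i_d_mem)

/-- The inclusion of the cycles. -/
noncomputable def cycleInclusion : ModuleCat.of R s.K ⟶ s.Z := ModuleCat.ofHom s.K.subtype

@[simp]
lemma iCycle_inclusion : s.iCycle ≫ s.cycleInclusion = X.d (n + 1) n ≫ s.i := rfl

@[simp]
lemma iCycle_inclusion_assoc {A : ModuleCat.{u} R} (f : s.Z ⟶ A) :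
    s.iCycle ≫ s.cycleInclusion ≫ f = X.d (n + 1) n ≫ s.i ≫ f := rfl

@[simp]
lemma boundaryCycle_p :
    s.boundaryCycle ≫ s.cycleInclusion ≫ s.p = s.boundaryFst ≫ Y.d (n + 1) n := by
  apply ModuleCat.hom_ext
  ext a : 1
  exact sub_eq_zero.1 a.2

/-- The intermediate module in the next degree. -/
noncomputable def nextZ : ModuleCat.{u} R := X.X (n + 1) ⊞ freeCover s.boundaryPairs

/-- The inclusion of the first summand. -/
noncomputable def nextInl : X.X (n + 1) ⟶ s.nextZ := biprod.inl

/-- The inclusion of the second summand. -/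
noncomputable def nextInr : freeCover s.boundaryPairs ⟶ s.nextZ := biprod.inr

/-- Maps out of the next intermediate module. -/
noncomputable def nextDesc {A : ModuleCat.{u} R} (a : X.X (n + 1) ⟶ A) (b : s.boundaryPairs ⟶ A) :
    s.nextZ ⟶ A := biprod.desc a (freeCoverπ _ ≫ b)

@[simp]
lemma nextInl_desc {A : ModuleCat.{u} R} (a : X.X (n + 1) ⟶ A) (b : s.boundaryPairs ⟶ A) :
    s.nextInl ≫ s.nextDesc a b = a := biprod.inl_desc _ _

@[simp]
lemma nextInr_desc {A : ModuleCat.{u} R} (a : X.X (n + 1) ⟶ A) (b : s.boundaryPairs ⟶ A) :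
    s.nextInr ≫ s.nextDesc a b = freeCoverπ _ ≫ b := biprod.inr_desc _ _

@[simp]
lemma nextInl_desc_assoc {A B : ModuleCat.{u} R} (a : X.X (n + 1) ⟶ A) (b : s.boundaryPairs ⟶ A)
    (f : A ⟶ B) : s.nextInl ≫ s.nextDesc a b ≫ f = a ≫ f := biprod.inl_desc_assoc _ _ _

@[simp]
lemma nextInr_desc_assoc {A B : ModuleCat.{u} R} (a : X.X (n + 1) ⟶ A) (b : s.boundaryPairs ⟶ A)
    (f : A ⟶ B) : s.nextInr ≫ s.nextDesc a b ≫ f = freeCoverπ _ ≫ b ≫ f := by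
  rw [← Category.assoc, nextInr_desc, Category.assoc]

lemma nextDesc_inr_mk {A : ModuleCat.{u} R} (a : X.X (n + 1) ⟶ A) (b : s.boundaryPairs ⟶ A)
    (x : s.boundaryPairs) : s.nextDesc a b (s.nextInr (freeCoverMk x)) = b x :=
  (ConcreteCategory.congr_hom (s.nextInr_desc a b) (freeCoverMk x)).trans
    (congrArg b (freeCoverDesc_mk id x))

lemma nextZ_hom_ext {A : ModuleCat.{u} R} {g h : s.nextZ ⟶ A} (h₁ : s.nextInl ≫ g = s.nextInl ≫ h)
    (h₂ : s.nextInr ≫ g = s.nextInr ≫ h) : g = h := biprod.hom_ext' _ _ h₁ h₂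

/-- The differential from the next stage. -/
noncomputable def nextd : s.nextZ ⟶ s.Z := s.nextDesc s.iCycle s.boundaryCycle ≫ s.cycleInclusion

/-- The projection to `Y` of the next stage. -/
noncomputable def nextp : s.nextZ ⟶ Y.X (n + 1) := s.nextDesc (f.f (n + 1)) s.boundaryFst

lemma nextd_p : s.nextd ≫ s.p = s.nextp ≫ Y.d (n + 1) n := by
  apply nextZ_hom_ext <;> simp [nextd, nextp, s.fac]

lemma nextd_mem (z : s.nextZ) : s.nextd z ∈ s.K := (s.nextDesc s.iCycle s.boundaryCycle z).2

lemma nextInl_d : s.nextInl ≫ s.nextd = X.d (n + 1) n ≫ s.i := by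
  simp [nextd]

/-- The next stage of the factorization. -/
noncomputable def next : FactorizationStage f (n + 1) where
  Z := s.nextZ
  K := LinearMap.ker s.nextd.hom
  i := s.nextInl
  p := s.nextp
  fac := s.nextInl_desc _ _
  i_d_mem x := by
    rw [LinearMap.mem_ker]
    have : X.d (n + 2) (n + 1) ≫ s.nextInl ≫ s.nextd = 0 := by
      simp [nextInl_d]
    exact ConcreteCategory.congr_hom this x

lemma next_d_nextd : s.next.nextd ≫ s.nextd = 0 := by
  apply ModuleCat.hom_ext
  ext z : 1
  exact s.next.nextd_mem z

variable (f) in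
/-- The stages of the factorization. -/
noncomputable def stage : ∀ n, FactorizationStage f n
  | 0 => zero f
  | n + 1 => (stage n).next

variable (f)

/-- The intermediate complex of the factorization. -/
noncomputable def complex : ChNN R :=
  ChainComplex.of (fun n => (stage f n).Z) (fun n => (stage f n).nextd)
    (fun n => (stage f n).next_d_nextd)

lemma complex_d (n : ℕ) : (complex f).d (n + 1) n = (stage f n).nextd :=
  ChainComplex.of_d (fun n => (stage f n).Z) (fun n => (stage f n).nextd) n

/-- The first map of the factorization. -/
noncomputable def complexι : X ⟶ complex f where
  f n := (stage f n).i
  comm' := by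
    rintro _ n rfl
    rw [complex_d]
    exact (stage f n).nextInl_d

/-- The second map of the factorization. -/
noncomputable def complexπ : complex f ⟶ Y where
  f n := (stage f n).p
  comm' := by
    rintro _ n rfl
    rw [complex_d]
    exact (stage f n).nextd_p.symm

lemma complex_fac : complexι f ≫ complexπ f = f := by
  ext n : 1
  exact (stage f n).fac

lemma projCof_complexι : projCof R (complexι f) :=
  (projCof_iff _).2 fun n => by
    obtain _ | n := n <;>
    exact epimorphisms_llp_of_decomposition biprod.inl biprod.fst biprod.snd biprod.inr (by simp)
      (by simp) biprod.total

lemma epi_complexπ_zero : Epi ((complexπ f).f 0) :=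
  epi_of_epi_fac (biprod.inr_desc (f.f 0) (freeCoverπ _))

lemma mem_K_of_d_eq_zero (n : ℕ) (z : (complex f).X n) (hz : (complex f).d n (n - 1) z = 0) :
    (show (stage f n).Z from z) ∈ (stage f n).K := by
  obtain _ | n := n
  · exact Submodule.mem_top (R := R) (M := (zero f).Z)
  · exact (ConcreteCategory.congr_hom (complex_d f n) z).symm.trans hz

/-- Holds by construction: each pair `(y, z)` indexes a generator attached in degree `n + 1`, which
maps to `y` and has boundary `z`. -/
lemma epi_toCycleFiber_complexπ (n : ℕ) : Epi (toCycleFiber (complexπ f) n) := by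
  rw [ModuleCat.epi_iff_surjective]
  rintro ⟨⟨y, z⟩, h⟩
  rw [mem_cycleFiber] at h
  let a := (stage f n).boundaryPairsMk y z (mem_K_of_d_eq_zero f n z h.1) h.2
  refine ⟨(stage f n).nextInr (freeCoverMk a), Subtype.ext (Prod.ext ?_ ?_)⟩
  · exact (stage f n).nextDesc_inr_mk _ _ a
  · refine (ConcreteCategory.congr_hom (complex_d f n) _).trans ?_
    exact congrArg (stage f n).cycleInclusion ((stage f n).nextDesc_inr_mk _ _ a)

end FactorizationStage

end Stages

open FactorizationStage in
instance projective_factorization_acyclicFib : MorphismProperty.HasFactorization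
    (projCof R) (epiPos R ⊓ quasiIso _ _) where
  nonempty_mapFactorizationData f := ⟨{
    Z := complex f
    i := complexι f
    p := complexπ f
    fac := complex_fac f
    hi := projCof_complexι f
    hp := ⟨epiPos_of_toCycleFiber (epi_complexπ_zero f) (epi_toCycleFiber_complexπ f),
      quasiIso_of_toCycleFiber (epi_complexπ_zero f) (epi_toCycleFiber_complexπ f)⟩ }⟩

/-! ### The projective and mixed model structures -/

variable (R)

/-- The projective model structure. -/
@[reducible]
noncomputable def projectiveModel : ModelCategory (ChNN R) :=
  modelCategoryOfFactorizations (quasiIso _ _) (projCof R) (epiPos R)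
    projCof_le_llp inferInstance inferInstance

lemma isProjectiveModel_projectiveModel : IsProjectiveModel R (projectiveModel R) :=
  ⟨rfl, rfl, rfl⟩

/-- The cofibrations of the mixed model structure. -/
abbrev mixedCof : MorphismProperty (ChNN R) :=
  (splitEpiPos R ⊓ quasiIso (ModuleCat.{u} R) (ComplexShape.down ℕ)).llp

lemma splitEpiPos_llp_le_mixedCof : (splitEpiPos R).llp ≤ mixedCof R :=
  MorphismProperty.antitone_llp inf_le_left

lemma projCof_le_mixedCof : projCof R ≤ mixedCof R :=
  projCof_le_llp.trans (MorphismProperty.antitone_llp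
    (inf_le_inf_right _ (splitEpiPos_le_epiPos R)))

/-- The bridge between lifting arguments and homotopy arguments: one side is stable under pushouts,
the other is easily checked on tensor products. -/
lemma hurewicz_llp_eq : (splitEpiPos R).llp =
    splitMonoDegreewise R ⊓ homotopyEquivalences (ModuleCat.{u} R) (ComplexShape.down ℕ) :=
  le_antisymm (llp_fib_le_acyclicCof _ _ _) (acyclicCof_le_llp _ _ _ splitMonoDegreewise_le_llp)

lemma splitMonoDegreewise_eq_llp : (splitEpiPos R ⊓ homotopyEquivalences (ModuleCat.{u} R)
    (ComplexShape.down ℕ)).llp = splitMonoDegreewise R :=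
  MorphismProperty.llp_eq_of_le_llp_of_hasFactorization_of_isStableUnderRetracts
    splitMonoDegreewise_le_llp

/-- Homotopy equivalences are quasi-isomorphisms, so mixed cofibrations lift against more fibrations
than Hurewicz cofibrations do. -/
lemma mixedCof_le_splitMonoDegreewise : mixedCof R ≤ splitMonoDegreewise R := by
  rw [← splitMonoDegreewise_eq_llp]
  exact MorphismProperty.antitone_llp (inf_le_inf_left _ (homotopyEquivalences_le_quasiIso _ _))

variable {R}

/-- Every map is a degreewise monomorphism with projective cokernel, followed by a map with the left
lifting property against Hurewicz fibrations, followed by an acyclic mixed fibration. -/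
lemma exists_mixed_factorization {X Y : ChNN R} (f : X ⟶ Y) :
    ∃ (Z Z' : ChNN R) (i : X ⟶ Z) (j : Z ⟶ Z') (p : Z' ⟶ Y), projCof R i ∧
      (splitEpiPos R).llp j ∧ (splitEpiPos R ⊓ quasiIso _ _) p ∧ i ≫ j ≫ p = f := by
  have h := MorphismProperty.factorizationData (projCof R) (epiPos R ⊓ quasiIso _ _) f
  have h' := MorphismProperty.factorizationData
    (splitMonoDegreewise R ⊓ homotopyEquivalences _ _ ⊓ (splitEpiPos R).llp) (splitEpiPos R) h.p
  have hp : quasiIso _ _ h'.p := MorphismProperty.of_precomp _ h'.i _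
    (homotopyEquivalences_le_quasiIso _ _ _ h'.hi.1.2) (by rw [h'.fac]; exact h.hp.2)
  exact ⟨_, _, h.i, h'.i, h'.p, h.hi, h'.hi.2, ⟨h'.hp, hp⟩, by rw [h'.fac, h.fac]⟩

instance mixed_factorization_acyclicFib : MorphismProperty.HasFactorization
    (mixedCof R) (splitEpiPos R ⊓ quasiIso _ _) where
  nonempty_mapFactorizationData f := by
    obtain ⟨Z, Z', i, j, p, hi, hj, hp, fac⟩ := exists_mixed_factorization f
    exact ⟨⟨Z', i ≫ j, p, by simpa using fac, (mixedCof R).comp_mem _ _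
      (projCof_le_mixedCof R _ hi) (splitEpiPos_llp_le_mixedCof R _ hj), hp⟩⟩

/-- The Hurewicz factorization serves unchanged, since the fibrations agree. -/
instance mixed_factorization_acyclicCof : MorphismProperty.HasFactorization
    (mixedCof R ⊓ quasiIso _ _ ⊓ (splitEpiPos R).llp) (splitEpiPos R) where
  nonempty_mapFactorizationData f := by
    have h := MorphismProperty.factorizationData
      (splitMonoDegreewise R ⊓ homotopyEquivalences _ _ ⊓ (splitEpiPos R).llp) (splitEpiPos R) f
    exact ⟨⟨h.Z, h.i, h.p, h.fac, ⟨⟨splitEpiPos_llp_le_mixedCof R _ h.hi.2,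
      homotopyEquivalences_le_quasiIso _ _ _ h.hi.1.2⟩, h.hi.2⟩, h.hp⟩⟩

variable (R) in
/-- The mixed model structure. -/
@[reducible]
noncomputable def mixedModel : ModelCategory (ChNN R) :=
  modelCategoryOfFactorizations (quasiIso _ _) (mixedCof R) (splitEpiPos R)
    le_rfl inferInstance inferInstance

lemma isMixedModel_mixedModel : IsMixedModel R (mixedModel R) := ⟨rfl, rfl, rfl⟩

lemma mixed_acyclicCof_le : mixedCof R ⊓ quasiIso _ _ ≤ (splitEpiPos R).llp :=
  acyclicCof_le_llp _ _ _ le_rfl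

lemma projective_acyclicCof_le : projCof R ⊓ quasiIso _ _ ≤ (splitEpiPos R).llp :=
  (acyclicCof_le_llp _ _ _ projCof_le_llp).trans
    (MorphismProperty.antitone_llp (splitEpiPos_le_epiPos R))

/-- Mixed cofibrations form the smallest class defined by a left lifting property which contains the
projective cofibrations and the Hurewicz acyclic cofibrations. -/
lemma mixedCof_le_llp (P : MorphismProperty (ChNN R)) (h : projCof R ≤ P.llp)
    (h' : (splitEpiPos R).llp ≤ P.llp) : mixedCof R ≤ P.llp := by
  intro X Y f hf
  obtain ⟨Z, Z', i, j, p, hi, hj, hp, fac⟩ := exists_mixed_factorization f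
  -- Lifting `f` against the last factor `p` exhibits it as a retract of `i ≫ j`.
  have := hf p hp
  exact MorphismProperty.of_retract
    (RetractArrow.ofLeftLiftingProperty ((Category.assoc i j p).trans fac))
    (P.llp.comp_mem _ _ (h _ hi) (h' _ hj))

end ChNN

/-! ### Tensor products and degreewise complements of pushout-products -/

namespace ChNN

variable {R : Type u} [CommRing R]

lemma homotopyEquivalences_whiskerRight {X Y : ChNN R} {f : X ⟶ Y}
    (hf : homotopyEquivalences _ _ f) (K : ChNN R) : homotopyEquivalences _ _ (f ▷ K) := by
  obtain ⟨e, rfl⟩ := hf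
  exact ⟨{
    hom := e.hom ▷ K
    inv := e.inv ▷ K
    homotopyHomInvId := ((Homotopy.ofEq (comp_whiskerRight _ _ _).symm).trans
      (mapBifunctorMapHomotopy₁ e.homotopyHomInvId (𝟙 K) (curriedTensor _)
        (ComplexShape.down ℕ))).trans (Homotopy.ofEq (id_whiskerRight X K))
    homotopyInvHomId := ((Homotopy.ofEq (comp_whiskerRight _ _ _).symm).trans
      (mapBifunctorMapHomotopy₁ e.homotopyInvHomId (𝟙 K) (curriedTensor _)
        (ComplexShape.down ℕ))).trans (Homotopy.ofEq (id_whiskerRight Y K)) }, rfl⟩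

lemma homotopyEquivalences_whiskerLeft (K : ChNN R) {X Y : ChNN R} {f : X ⟶ Y}
    (hf : homotopyEquivalences _ _ f) : homotopyEquivalences _ _ (K ◁ f) :=
  ((homotopyEquivalences _ _).arrow_mk_iso_iff (Arrow.isoMk (β_ X K) (β_ Y K)
    (BraidedCategory.braiding_naturality_left f K).symm)).1 (homotopyEquivalences_whiskerRight hf K)

section

variable {X Y V W : ChNN R} {i : X ⟶ Y} {k : V ⟶ W} (sq : (curriedTensor (ChNN R)).PushoutObjObj i k)

/-- The pushout-product map, as a map to the tensor product. -/
abbrev tensorι : sq.pt ⟶ Y ⊗ W := sq.ι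

lemma pushoutObjObj_hom_ext {n : ℕ} {A : ModuleCat.{u} R} {f g : sq.pt.X n ⟶ A}
    (h₁ : sq.inl.f n ≫ f = sq.inl.f n ≫ g) (h₂ : sq.inr.f n ≫ f = sq.inr.f n ≫ g) : f = g :=
  (sq.isPushout.map (HomologicalComplex.eval (ModuleCat.{u} R) (ComplexShape.down ℕ) n)).hom_ext
    h₁ h₂

lemma inl_ι_f (n : ℕ) : sq.inl.f n ≫ (tensorι sq).f n = (Y ◁ k).f n := by
  refine Eq.trans (comp_f _ _ _).symm ?_
  rw [sq.inl_ι]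
  rfl

lemma inr_ι_f (n : ℕ) : sq.inr.f n ≫ (tensorι sq).f n = (i ▷ W).f n := by
  refine Eq.trans (comp_f _ _ _).symm ?_
  rw [sq.inr_ι]
  rfl

lemma pushoutObjObj_w_f (n : ℕ) : (i ▷ V).f n ≫ sq.inl.f n = (X ◁ k).f n ≫ sq.inr.f n := by
  rw [← comp_f, ← comp_f]
  exact congrArg (fun g => g.f n) sq.isPushout.w

/-- A retraction of the pushout-product in degree `n`, for given degreewise retractions `r` and `s`
and a complement `e` of the retraction `s`. -/
noncomputable def pushoutProductRetraction (r : ∀ n, Y.X n ⟶ X.X n) (s : ∀ n, W.X n ⟶ V.X n)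
    (e : ∀ n, W.X n ⟶ W.X n) (n : ℕ) : (Y ⊗ W).X n ⟶ sq.pt.X n :=
  desc fun p q h => Y.X p ◁ s q ≫ incl Y V p q n h ≫ sq.inl.f n +
    r p ▷ W.X q ≫ X.X p ◁ e q ≫ incl X W p q n h ≫ sq.inr.f n

variable {r : ∀ n, Y.X n ⟶ X.X n} {s : ∀ n, W.X n ⟶ V.X n} {e : ∀ n, W.X n ⟶ W.X n}

/-- The two summands of the formula split `W` as `V` plus a complement: `1 ⊗ s` lands in `Y ⊗ V` and
`r ⊗ e` in `X ⊗ W`. On `X ⊗ W` they recombine because the two images of `X ⊗ V` are glued in the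
pushout. -/
lemma ι_pushoutProductRetraction (hr : ∀ n, i.f n ≫ r n = 𝟙 _) (hs : ∀ n, k.f n ≫ s n = 𝟙 _)
    (hke : ∀ n, k.f n ≫ e n = 0) (he : ∀ n, s n ≫ k.f n + e n = 𝟙 _) (n : ℕ) :
    (tensorι sq).f n ≫ pushoutProductRetraction sq r s e n = 𝟙 _ := by
  apply pushoutObjObj_hom_ext
  · rw [← Category.assoc, inl_ι_f]
    apply tensor_hom_ext
    intro p q h
    rw [incl_whiskerLeft_assoc, pushoutProductRetraction, incl_desc, Preadditive.comp_add,
      whisker_exchange_assoc, ← MonoidalCategory.whiskerLeft_comp_assoc,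
      ← MonoidalCategory.whiskerLeft_comp_assoc, hs, hke]
    simp
  · rw [← Category.assoc, inr_ι_f]
    apply tensor_hom_ext
    intro p q h
    rw [incl_whiskerRight_assoc, pushoutProductRetraction, incl_desc, Preadditive.comp_add,
      ← whisker_exchange_assoc, ← comp_whiskerRight_assoc, hr, ← incl_whiskerRight_assoc,
      pushoutObjObj_w_f, incl_whiskerLeft_assoc, ← MonoidalCategory.whiskerLeft_comp_assoc,
      id_whiskerRight, Category.id_comp, ← Preadditive.add_comp,
      ← MonoidalPreadditive.whiskerLeft_add, he]
    simp

/-- Identifies the idempotent complementary to the image of the pushout-product as `e' ⊗ e`, the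
tensor product of the complementary idempotents. -/
lemma incl_pushoutProductRetraction_ι {e' : ∀ n, Y.X n ⟶ Y.X n}
    (he : ∀ n, s n ≫ k.f n + e n = 𝟙 _) (he' : ∀ n, r n ≫ i.f n + e' n = 𝟙 _) (p q n : ℕ)
    (h : p + q = n) :
    incl Y W p q n h ≫ pushoutProductRetraction sq r s e n ≫ (tensorι sq).f n +
      (e' p ⊗ₘ e q) ≫ incl Y W p q n h = incl Y W p q n h := by
  rw [pushoutProductRetraction, incl_desc_assoc, Preadditive.add_comp]
  simp only [Category.assoc, inl_ι_f, inr_ι_f, incl_whiskerLeft, incl_whiskerRight]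
  rw [whisker_exchange_assoc, ← MonoidalCategory.whiskerLeft_comp_assoc,
    ← comp_whiskerRight_assoc, MonoidalCategory.tensorHom_def, Category.assoc, add_assoc,
    ← Preadditive.add_comp, ← MonoidalPreadditive.add_whiskerRight, he', id_whiskerRight,
    Category.id_comp, ← Preadditive.add_comp, ← MonoidalPreadditive.whiskerLeft_add, he,
    MonoidalCategory.whiskerLeft_id, Category.id_comp]

lemma splitMonoDegreewise_pushoutProduct (hi : splitMonoDegreewise R i)
    (hk : splitMonoDegreewise R k) : splitMonoDegreewise R sq.ι := fun n =>
  ⟨⟨pushoutProductRetraction sq (fun n => (hi n).exists_splitMono.some.retraction)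
    (fun n => (hk n).exists_splitMono.some.retraction)
    (fun n => 𝟙 _ - (hk n).exists_splitMono.some.retraction ≫ k.f n) n,
    ι_pushoutProductRetraction sq (fun n => (hi n).exists_splitMono.some.id)
      (fun n => (hk n).exists_splitMono.some.id)
      (fun n => by
        rw [Preadditive.comp_sub, ← Category.assoc, (hk n).exists_splitMono.some.id]
        simp)
      (fun n => add_sub_cancel _ _) n⟩⟩

instance projective_tensor (P Q : ModuleCat.{u} R) [Projective P] [Projective Q] :
    Projective (P ⊗ Q) := by
  have := (IsProjective.iff_projective P).2 ‹_›
  have := (IsProjective.iff_projective Q).2 ‹_›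
  exact (IsProjective.iff_projective (TensorProduct R P Q)).1 inferInstance

/-- In degree `n` the complement is the sum of the projectives `P x ⊗ Q y` with `x + y = n`; the
lift is assembled from the retraction and from lifts on these summands. -/
lemma projCof_pushoutProduct (hi : projCof R i) (hk : projCof R k) : projCof R sq.ι := by
  rw [projCof_iff] at hi hk ⊢
  choose P r c t hP hr hc ht using fun n =>
    exists_projective_complement (i.f n) ((epimorphisms_llp_iff _).1 (hi n))
  choose Q s d u hQ hs hd hu using fun n =>
    exists_projective_complement (k.f n) ((epimorphisms_llp_iff _).1 (hk n))
  intro n E F p (hp : Epi p)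
  refine ⟨fun {a b} w => ?_⟩
  have hke (n) : k.f n ≫ d n ≫ u n = 0 := by rw [reassoc_of% hd n, zero_comp]
  -- The part of the lift on the complement; it vanishes on both legs of the pushout because `c`
  -- kills `i` and `d` kills `k`.
  let l : (Y ⊗ W).X n ⟶ E := desc fun x y h =>
    (c x ⊗ₘ d y) ≫ Projective.factorThru ((t x ⊗ₘ u y) ≫ incl Y W x y n h ≫ b) p
  have hl : (tensorι sq).f n ≫ l = 0 := by
    apply pushoutObjObj_hom_ext
    · rw [← Category.assoc, inl_ι_f]
      apply tensor_hom_ext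
      intro x y h
      rw [incl_whiskerLeft_assoc, incl_desc, MonoidalCategory.tensorHom_def, Category.assoc,
        whisker_exchange_assoc, ← MonoidalCategory.whiskerLeft_comp_assoc, hd]
      simp
    · rw [← Category.assoc, inr_ι_f]
      apply tensor_hom_ext
      intro x y h
      rw [incl_whiskerRight_assoc, incl_desc, MonoidalCategory.tensorHom_def, Category.assoc,
        ← comp_whiskerRight_assoc, hc]
      simp
  refine ⟨⟨{
    l := pushoutProductRetraction sq r s (fun n => d n ≫ u n) n ≫ a + l
    fac_left := ?_
    fac_right := ?_ }⟩⟩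
  · rw [Preadditive.comp_add, ← Category.assoc, ι_pushoutProductRetraction sq hr hs hke hu, hl]
    simp
  · apply tensor_hom_ext
    intro x y h
    have h' := incl_pushoutProductRetraction_ι sq (r := r) hu ht x y n h
    rw [← tensorHom_comp_tensorHom] at h'
    have hlp : incl Y W x y n h ≫ l ≫ p =
        (c x ⊗ₘ d y) ≫ (t x ⊗ₘ u y) ≫ incl Y W x y n h ≫ b := by
      rw [incl_desc_assoc, Category.assoc, Projective.factorThru_comp]
    rw [Preadditive.add_comp, Preadditive.comp_add, hlp, Category.assoc, w.w]
    simpa using h' =≫ b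

end

end ChNN

/-! ### Pushout-products of acyclic and of mixed cofibrations -/

namespace ChNN

open EnrichedModel

variable {R : Type u} [CommRing R]

lemma splitMonoDegreewise_whiskerRight {X Y : ChNN R} {i : X ⟶ Y} (hi : splitMonoDegreewise R i)
    (V : ChNN R) : splitMonoDegreewise R (i ▷ V) := fun n =>
  ⟨⟨desc fun p q h => (hi p).exists_splitMono.some.retraction ▷ V.X q ≫ incl X V p q n h, by
    apply tensor_hom_ext
    intro p q h
    rw [incl_whiskerRight_assoc, incl_desc, ← comp_whiskerRight_assoc,
      (hi p).exists_splitMono.some.id]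
    simp⟩⟩

lemma splitEpiPos_llp_whiskerRight {X Y : ChNN R} {i : X ⟶ Y} (hi : (splitEpiPos R).llp i)
    (V : ChNN R) : (splitEpiPos R).llp (i ▷ V) := by
  rw [hurewicz_llp_eq] at hi ⊢
  exact ⟨splitMonoDegreewise_whiskerRight hi.1 V, homotopyEquivalences_whiskerRight hi.2 V⟩

section

variable {X Y V W : ChNN R} {i : X ⟶ Y} {k : V ⟶ W} (sq : (curriedTensor (ChNN R)).PushoutObjObj i k)

/-- The leg `sq.inr` is a cobase change of `i ▷ V`, hence a homotopy equivalence, and its composite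
with the pushout-product is the homotopy equivalence `i ▷ W`. Two out of three applies. -/
lemma homotopyEquivalences_pushoutProduct_left (hi : (splitEpiPos R).llp i) :
    homotopyEquivalences _ _ sq.ι := by
  have h : (splitEpiPos R).llp sq.inr :=
    MorphismProperty.of_isPushout sq.isPushout.flip (splitEpiPos_llp_whiskerRight hi V)
  have hi' := splitEpiPos_llp_whiskerRight hi W
  rw [hurewicz_llp_eq] at h hi'
  refine MorphismProperty.of_precomp _ sq.inr _ h.2 ?_
  rw [sq.inr_ι]
  exact hi'.2

lemma homotopyEquivalences_pushoutProduct_right (hk : (splitEpiPos R).llp k) :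
    homotopyEquivalences _ _ sq.ι := by
  have h := homotopyEquivalences_pushoutProduct_left sq.flipTensor hk
  rw [Functor.PushoutObjObj.flipTensor_ι] at h
  exact (MorphismProperty.cancel_right_of_respectsIso _ _ _).1 h

lemma splitEpiPos_llp_pushoutProduct_left (hi : (splitEpiPos R).llp i)
    (hk : splitMonoDegreewise R k) : (splitEpiPos R).llp sq.ι := by
  rw [hurewicz_llp_eq]
  refine ⟨splitMonoDegreewise_pushoutProduct sq ?_ hk, homotopyEquivalences_pushoutProduct_left sq hi⟩
  rw [hurewicz_llp_eq] at hi
  exact hi.1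

lemma mixedCof_flipTensor : mixedCof R sq.flipTensor.ι ↔ mixedCof R sq.ι := by
  rw [Functor.PushoutObjObj.flipTensor_ι]
  exact MorphismProperty.cancel_right_of_respectsIso _ _ _

lemma splitEpiPos_llp_pushoutProduct_right (hi : splitMonoDegreewise R i)
    (hk : (splitEpiPos R).llp k) : (splitEpiPos R).llp sq.ι := by
  have h := splitEpiPos_llp_pushoutProduct_left sq.flipTensor hk hi
  rw [Functor.PushoutObjObj.flipTensor_ι] at h
  exact (MorphismProperty.cancel_right_of_respectsIso _ _ _).1 h

/-- If the pushout-products of `i` with projective cofibrations are mixed cofibrations, then so are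
the pushout-products of `i` with mixed cofibrations. -/
lemma mixedCof_pushoutProduct_of_projCof (hi : mixedCof R i) (hk : mixedCof R k)
    (h : ∀ {V' W' : ChNN R} (k' : V' ⟶ W') (sq' : (curriedTensor (ChNN R)).PushoutObjObj i k'),
      projCof R k' → mixedCof R sq'.ι) : mixedCof R sq.ι := by
  -- The condition on `k` is now a left lifting property, so it may be checked on projective
  -- cofibrations and on Hurewicz acyclic cofibrations.
  refine (pushoutProduct_mem_llp_iff i _ k sq).2 ?_
  refine mixedCof_le_llp _ (fun V' W' k' hk' => ?_) (fun V' W' k' hk' => ?_) _ hk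
  · refine (pushoutProduct_mem_llp_iff i _ k' (.ofHasPushout _ _ _)).1 ?_
    exact h _ _ hk'
  · refine (pushoutProduct_mem_llp_iff i _ k' (.ofHasPushout _ _ _)).1 ?_
    exact splitEpiPos_llp_le_mixedCof R _ (splitEpiPos_llp_pushoutProduct_right _
      (mixedCof_le_splitMonoDegreewise R _ hi) hk')

/-- First `k` is reduced to a projective cofibration; after exchanging the factors by symmetry, the
same reduction applies to `i`, which leaves two projective cofibrations. -/
lemma mixedCof_pushoutProduct (hi : mixedCof R i) (hk : mixedCof R k) : mixedCof R sq.ι :=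
  mixedCof_pushoutProduct_of_projCof sq hi hk fun _ sq' hk' =>
    (mixedCof_flipTensor sq').1 (mixedCof_pushoutProduct_of_projCof _
      (projCof_le_mixedCof R _ hk') hi fun _ sq'' hk'' =>
        projCof_le_mixedCof R _ (projCof_pushoutProduct sq'' hk' hk''))

end

/-! ### Mixed cofibrant objects and the unit -/

section Cofibrant

/-- The map `t` is split epi, and mono because `t ≫ p` is; so it is invertible, and `p` with it.
Applied in the homotopy category. -/
lemma isIso_of_split {C : Type u} [Category.{v} C] {P T S : C} (σ : P ⟶ T) (t : T ⟶ P) (p : P ⟶ S)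
    (hσ : σ ≫ t = 𝟙 P) [IsIso (t ≫ p)] : IsIso p := by
  have : IsSplitEpi t := ⟨⟨⟨σ, hσ⟩⟩⟩
  have : Mono t := mono_of_mono t p
  have : IsIso t := isIso_of_mono_of_isSplitEpi t
  exact IsIso.of_isIso_comp_left t p

lemma exists_section_of_mixedCof {X Y A : ChNN R} (hA : IsInitial A) (p : X ⟶ Y)
    (hY : mixedCof R (hA.to Y)) (hp : splitEpiPos R p) (hq : quasiIso _ _ p) :
    ∃ s : Y ⟶ X, s ≫ p = 𝟙 Y := by
  have := hY p ⟨hp, hq⟩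
  have sq : CommSq (hA.to X) (hA.to Y) p (𝟙 Y) := ⟨hA.hom_ext _ _⟩
  exact ⟨sq.lift, sq.fac_right⟩

/-- A quasi-isomorphism between cofibrant objects of the mixed model structure is a homotopy
equivalence. -/
lemma homotopyEquivalences_of_mixedCof {X Y A : ChNN R} (hA : IsInitial A) (p : X ⟶ Y)
    (hX : mixedCof R (hA.to X)) (hY : mixedCof R (hA.to Y)) (hp : quasiIso _ _ p) :
    homotopyEquivalences _ _ p := by
  -- This reduces the claim to a fibration `h.p` with cofibrant source and target, which then has a
  -- section `s`.
  have h := MorphismProperty.factorizationData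
    (splitMonoDegreewise R ⊓ homotopyEquivalences _ _ ⊓ (splitEpiPos R).llp) (splitEpiPos R) p
  rw [← h.fac]
  refine MorphismProperty.comp_mem _ _ _ h.hi.1.2 ?_
  have hpq : quasiIso _ _ h.p := MorphismProperty.of_precomp _ h.i _
    (homotopyEquivalences_le_quasiIso _ _ _ h.hi.1.2) (by rwa [h.fac])
  have hZ : mixedCof R (hA.to h.Z) := by
    rw [hA.hom_ext (hA.to h.Z) (hA.to X ≫ h.i)]
    exact (mixedCof R).comp_mem _ _ hX (splitEpiPos_llp_le_mixedCof R _ h.hi.2)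
  obtain ⟨s, hs⟩ := exists_section_of_mixedCof hA h.p hY h.hp hpq
  have hsq : quasiIso _ _ s := MorphismProperty.of_postcomp _ s h.p hpq (by
    rw [hs]; exact MorphismProperty.id_mem _ _)
  -- The section `s` need not be a fibration; up to a homotopy equivalence it is replaced by the
  -- acyclic mixed fibration `h'.p`, which has a section `σ` because `h.Z` is cofibrant.
  have h' := MorphismProperty.factorizationData
    (splitMonoDegreewise R ⊓ homotopyEquivalences _ _ ⊓ (splitEpiPos R).llp) (splitEpiPos R) s
  have htq : quasiIso _ _ h'.p := MorphismProperty.of_precomp _ h'.i _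
    (homotopyEquivalences_le_quasiIso _ _ _ h'.hi.1.2) (by rwa [h'.fac])
  obtain ⟨σ, hσ⟩ := exists_section_of_mixedCof hA h'.p hZ h'.hp htq
  -- Since `h'.i ≫ h'.p ≫ h.p = s ≫ h.p` is the identity and `h'.i` is a homotopy equivalence, so is
  -- `h'.p ≫ h.p`.
  have htp : homotopyEquivalences _ _ (h'.p ≫ h.p) := MorphismProperty.of_precomp _ h'.i _
    h'.hi.1.2 (by rw [h'.fac_assoc, hs]; exact MorphismProperty.id_mem _ _)
  rw [← isIso_quotient_map_iff_homotopyEquivalences] at htp ⊢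
  rw [Functor.map_comp] at htp
  exact isIso_of_split ((HomotopyCategory.quotient _ _).map σ) _ _
    (by rw [← Functor.map_comp, hσ, CategoryTheory.Functor.map_id])

lemma projCof_to_of_projective {A X : ChNN R} (hA : IsInitial A) [∀ n, Projective (X.X n)] :
    projCof R (hA.to X) := by
  rw [projCof_iff]
  intro n
  have h0 : IsZero (A.X n) := (HomologicalComplex.eval _ _ n).map_isZero
    (hA.isZero)
  exact epimorphisms_llp_of_decomposition _ 0 (𝟙 _) (𝟙 _) (h0.eq_of_src _ _) (h0.eq_of_src _ _)
    (by simp)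

instance projective_tensorUnit (n : ℕ) : Projective ((𝟙_ (ChNN R)).X n) := by
  change Projective (((single (ModuleCat.{u} R) (ComplexShape.down ℕ) 0).obj
    (𝟙_ (ModuleCat.{u} R))).X n)
  have : Projective (𝟙_ (ModuleCat.{u} R)) :=
    ModuleCat.projective_of_free (Module.Basis.singleton Unit R)
  obtain _ | n := n
  · exact Projective.of_iso (singleObjXSelf (ComplexShape.down ℕ) 0 (𝟙_ (ModuleCat.{u} R))).symm
      inferInstance
  · exact (isZero_single_obj_X (ComplexShape.down ℕ) 0 (𝟙_ (ModuleCat.{u} R)) (n + 1)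
      (by simp)).projective

/-- A cofibrant replacement of the unit in the mixed model structure stays a homotopy equivalence
after tensoring with any complex. -/
lemma homotopyEquivalences_unit (X Q : ChNN R) (q : Q ⟶ 𝟙_ (ChNN R))
    (hQ : mixedCof R (initial.to Q)) (hq : quasiIso _ _ q) :
    homotopyEquivalences _ _ (X ◁ q ≫ (ρ_ X).hom) :=
  MorphismProperty.comp_mem _ _ _ (homotopyEquivalences_whiskerLeft X
    (homotopyEquivalences_of_mixedCof (R := R) initialIsInitial q hQ
      (projCof_le_mixedCof R _ (projCof_to_of_projective (R := R) initialIsInitial)) hq))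
    (homotopyEquivalences.of_isIso _)

end Cofibrant

/-! ### Verification of the monoidal and enriched axioms -/

section Enrichment

open scoped MonoidalClosed

/-- A criterion for the axioms of a monoidal or enriched model category in terms of the classes of
cofibrations and acyclic cofibrations. -/
lemma pushoutProductAxiom_of (MV MC : ModelCategory (ChNN R))
    (hcof : ∀ ⦃X Y V W : ChNN R⦄ ⦃i : X ⟶ Y⦄ ⦃k : V ⟶ W⦄
      (sq : (curriedTensor (ChNN R)).PushoutObjObj i k), cof MC i → cof MV k → cof MC sq.ι)
    (hC : cof MC ⊓ weq MC ≤ (splitEpiPos R).llp) (hV : cof MV ⊓ weq MV ≤ (splitEpiPos R).llp)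
    (hW : homotopyEquivalences _ _ ≤ weq MC) :
    PushoutProductAxiom (curriedTensor (ChNN R)) MV MC :=
  fun _ _ _ _ _ _ hi hk sq => ⟨hcof sq hi hk, fun h => hW _ (h.elim
    (fun h => homotopyEquivalences_pushoutProduct_left sq (hC _ ⟨hi, h⟩))
    (fun h => homotopyEquivalences_pushoutProduct_right sq (hV _ ⟨hk, h⟩)))⟩

lemma unitAxiom_of (MV MC : ModelCategory (ChNN R)) (hcof : cof MV ≤ mixedCof R)
    (hV : weq MV = quasiIso _ _) (hW : homotopyEquivalences _ _ ≤ weq MC) :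
    UnitAxiom (curriedTensor (ChNN R)) (fun X => (ρ_ X).hom) MV MC :=
  fun X _ Q q hQ hq => hW _ (homotopyEquivalences_unit X Q q
    (hcof _ (letI := MV; hQ.mem)) (hV ▸ hq))

variable (R)

lemma isMonoidalModelCategory_projective : IsMonoidalModelCategory (projectiveModel R) where
  pushoutProduct := pushoutProductAxiom_of _ _ (fun _ _ _ _ _ _ sq => projCof_pushoutProduct sq)
    projective_acyclicCof_le
    projective_acyclicCof_le (homotopyEquivalences_le_quasiIso _ _)
  unit := unitAxiom_of _ _ (projCof_le_mixedCof R) rfl (homotopyEquivalences_le_quasiIso _ _)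

lemma isMonoidalModelCategory_mixed : IsMonoidalModelCategory (mixedModel R) where
  pushoutProduct := pushoutProductAxiom_of _ _ (fun _ _ _ _ _ _ sq => mixedCof_pushoutProduct sq)
    mixed_acyclicCof_le
    mixed_acyclicCof_le (homotopyEquivalences_le_quasiIso _ _)
  unit := unitAxiom_of _ _ le_rfl rfl (homotopyEquivalences_le_quasiIso _ _)

lemma enrichedOver_hurewicz_projective : EnrichedOver (hurewicz R) (projectiveModel R) where
  monoidal := isMonoidalModelCategory_projective R
  pushoutProduct := pushoutProductAxiom_of _ _
    (fun _ _ _ _ _ _ sq hi hk => splitMonoDegreewise_pushoutProduct sq hi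
      (mixedCof_le_splitMonoDegreewise R _ (projCof_le_mixedCof R _ hk)))
    (hurewicz_llp_eq R).ge projective_acyclicCof_le le_rfl
  unit := unitAxiom_of _ _ (projCof_le_mixedCof R) rfl le_rfl

lemma enrichedOver_hurewicz_mixed : EnrichedOver (hurewicz R) (mixedModel R) where
  monoidal := isMonoidalModelCategory_mixed R
  pushoutProduct := pushoutProductAxiom_of _ _
    (fun _ _ _ _ _ _ sq hi hk => splitMonoDegreewise_pushoutProduct sq hi
      (mixedCof_le_splitMonoDegreewise R _ hk))
    (hurewicz_llp_eq R).ge mixed_acyclicCof_le le_rfl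
  unit := unitAxiom_of _ _ le_rfl rfl le_rfl

lemma enrichedOver_mixed_projective : EnrichedOver (mixedModel R) (projectiveModel R) where
  monoidal := isMonoidalModelCategory_projective R
  pushoutProduct := pushoutProductAxiom_of _ _
    (fun _ _ _ _ _ _ sq hi hk => mixedCof_pushoutProduct sq hi (projCof_le_mixedCof R _ hk))
    mixed_acyclicCof_le projective_acyclicCof_le (homotopyEquivalences_le_quasiIso _ _)
  unit := unitAxiom_of _ _ (projCof_le_mixedCof R) rfl (homotopyEquivalences_le_quasiIso _ _)

end Enrichment

end ChNN

theorem proposition3p4 (R : Type u) [CommRing R] :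
    ∃ q h m : ModelCategory (ChNN R),
      ChNN.IsProjectiveModel R q ∧ ChNN.IsHurewiczModel R h ∧ ChNN.IsMixedModel R m ∧
        ChNN.EnrichedOver h q ∧ ChNN.EnrichedOver h m ∧ ChNN.EnrichedOver m q :=
  ⟨ChNN.projectiveModel R, ChNN.hurewicz R, ChNN.mixedModel R,
    ChNN.isProjectiveModel_projectiveModel R, ChNN.isHurewiczModel_hurewicz,
    ChNN.isMixedModel_mixedModel, ChNN.enrichedOver_hurewicz_projective R,
    ChNN.enrichedOver_hurewicz_mixed R, ChNN.enrichedOver_mixed_projective R⟩
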